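/- Let $n\ge 1$ be an integer, let $q,t\in\mathbb{C}^\ast$ with $|q|<1$, and let $s=(s_1,\ldots,s_n)\in(\mathbb{C}^\ast)^n$ satisfy $s_j/s_i\notin\{q^m : m\in\mathbb{Z}\setminus\{0\}\}$ for all $1\le i<j\le n$. Let $$R=\mathbb{C}[[px_1/x_n,\,x_2/x_1,\,\ldots,\,x_n/x_{n-1}]]$$ be the ring of formal power series in the $n$ variables $z_0=px_1/x_n$, $z_k=x_{k+1}/x_k$ $(1\le k\le n-1)$; it contains $\mathbb{C}[[p]]$ through $p=z_0z_1\cdots z_{n-1}$. Put $\theta(z;p)=\prod_{k\ge0}(1-p^kz)(1-p^{k+1}/z)$, and for $I\subseteq\{1,\ldots,n\}$ let $$\mathcal{B}_I(x;p)=\prod_{\substack{1\le i<j\le n\\ i\in I,\,j\notin I}}\frac{\theta(x_j/(tx_i);p)}{\theta(x_j/x_i;p)}\prod_{\substack{1\le i<j\le n\\ i\notin I,\,j\in I}}\frac{\theta(tx_j/x_i;p)}{\theta(x_j/x_i;p)}\in R,$$ expanded as a power series in $z_0,\ldots,z_{n-1}$. Let $T_{q,x_i}$ be the $q$-shift operator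 $x_i\mapsto qx_i$ (with $p$ and the other $x_j$ fixed), acting on $R$. The modified elliptic Ruijsenaars operators are the operators $$\mathcal{E}^{(r)}_{x,s}(p)=\sum_{I\subseteq\{1,\ldots,n\},\ |I|=r}\Big(\prod_{i\in I}s_i\Big)\,\mathcal{B}_I(x;p)\prod_{i\in I}T_{q,x_i}\qquad(r=1,\ldots,n)$$ on $R$. A *formal solution* is an $f\in R$ with leading term $1$ (that is, with constant term $1$ as a power series in $z_0,\ldots,z_{n-1}$) such that $\mathcal{E}^{(r)}_{x,s}(p)f=\varepsilon^{(r)}(s;p)f$ for $r=1,\ldots,n$ with some formal eigenvalues $\varepsilon^{(r)}(s;p)\in\mathbb{C}[[p]]$. Then a formal solution $f(x;s;p)$ exists. The formal eigenvalues $\varepsilon^{(r)}(s;p)$ $(r=1,\ldots,n)$ are uniquely determined, i.e. they are the same for all formal solutions. The formal solution is unique up to multiplication by a power series in $p$ with constant term $1$: an element $g\in R$ is a formal solution if and only if $g=\gamma(s;p)\,f(x;s;p)$ for some $\gamma(s;p)\in\mathbb{C}[[p]]$ with $\gamma(s;0)=1$. -/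

import Mathlib

/-!
The ring `ℂ⟦p x₁/xₙ, x₂/x₁, …, xₙ/xₙ₋₁⟧` is `MvPowerSeries (Fin n) ℂ`.  The position variables
are indexed by `Fin n` (so `x i` is the variable usually written `x_{i+1}`), and the variable
`X k` of the ring stands for `z_k`, where `z_0 = p x_0 / x_{n-1}` and `z_k = x_k / x_{k-1}`
for `k ≠ 0`.
-/

namespace Ruijsenaars

noncomputable section

/-- The nome `p = z_0 z_1 ⋯ z_{n-1}` as an element of the ring. -/
def nome (n : ℕ) : MvPowerSeries (Fin n) ℂ :=
  ∏ k : Fin n, MvPowerSeries.X k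

/-- For `i < j`: the monomial `x_j / x_i = z_{i+1} ⋯ z_j`. -/
def ratio {n : ℕ} (i j : Fin n) : MvPowerSeries (Fin n) ℂ :=
  ∏ k ∈ Finset.Ioc i j, MvPowerSeries.X k

/-- For `i < j`: the monomial `p x_i / x_j`, the product of all `z_k` that do not occur in
`x_j / x_i`. -/
def nomeRatio {n : ℕ} (i j : Fin n) : MvPowerSeries (Fin n) ℂ :=
  ∏ k ∈ (Finset.Ioc i j)ᶜ, MvPowerSeries.X k

/-- `p = (x_j / x_i) · (p x_i / x_j)`. -/
theorem ratio_mul_nomeRatio {n : ℕ} (i j : Fin n) : ratio i j * nomeRatio i j = nome n :=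
  Finset.prod_mul_prod_compl _ _

open scoped MvPowerSeries.WithPiTopology in
/-- The infinite shifted factorial `(a; p)_∞ = ∏_{k ≥ 0} (1 - p^k a)`, an infinite product of
formal power series (coefficientwise convergence). -/
def pochhammerInf {n : ℕ} (a : MvPowerSeries (Fin n) ℂ) : MvPowerSeries (Fin n) ℂ :=
  ∏' k : ℕ, (1 - nome n ^ k * a)

open scoped MvPowerSeries.WithPiTopology in
/-- The product that defines `(a; p)_∞` converges. -/
theorem multipliable_pochhammerInf {n : ℕ} [NeZero n] (a : MvPowerSeries (Fin n) ℂ) :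
    Multipliable fun k : ℕ => (1 - nome n ^ k * a) := by
  have hp : (1 : ℕ∞) ≤ (nome n).order := by
    rw [MvPowerSeries.one_le_order_iff_constCoeff_eq_zero]
    simp [nome, map_prod, NeZero.ne n]
  have h : Filter.Tendsto (fun k : ℕ => (-(nome n ^ k * a)).order) Filter.atTop (nhds ⊤) := by
    refine tendsto_of_tendsto_of_tendsto_of_le_of_le
      (g := fun k : ℕ => (k : ℕ∞)) ENat.tendsto_natCast_nhds_top tendsto_const_nhds ?_ ?_
    · intro k
      have h1 : (k : ℕ∞) ≤ (nome n ^ k).order := by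
        refine le_trans ?_ (MvPowerSeries.le_order_pow k)
        simpa using nsmul_le_nsmul_right hp k
      change (k : ℕ∞) ≤ (-(nome n ^ k * a)).order
      rw [MvPowerSeries.order_neg]
      exact le_trans (le_trans h1 le_self_add) MvPowerSeries.le_order_mul
    · intro k
      exact le_top
  simpa [sub_eq_add_neg] using
    MvPowerSeries.WithPiTopology.multipliable_one_add_of_tendsto_order_atTop_nhds_top h

/-- For `i < j` and `c ≠ 0`: the theta function
`θ(c x_j / x_i; p) = (c x_j / x_i; p)_∞ (c⁻¹ p x_i / x_j; p)_∞`. -/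
def theta {n : ℕ} (c : ℂ) (i j : Fin n) : MvPowerSeries (Fin n) ℂ :=
  pochhammerInf (MvPowerSeries.C c * ratio i j) *
    pochhammerInf (MvPowerSeries.C c⁻¹ * nomeRatio i j)

/-- The coefficient `𝓑_I(x; p)`.  For `i < j` the series `θ(x_j / x_i; p)` has constant term `1`,
so that its inverse is a genuine inverse in the ring. -/
def coeffB {n : ℕ} (t : ℂ) (I : Finset (Fin n)) : MvPowerSeries (Fin n) ℂ :=
  (∏ ij : Fin n × Fin n with ij.1 < ij.2 ∧ ij.1 ∈ I ∧ ij.2 ∉ I,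
      theta t⁻¹ ij.1 ij.2 * (theta 1 ij.1 ij.2)⁻¹) *
    ∏ ij : Fin n × Fin n with ij.1 < ij.2 ∧ ij.1 ∉ I ∧ ij.2 ∈ I,
      theta t ij.1 ij.2 * (theta 1 ij.1 ij.2)⁻¹

/-- The exponent of `x_i` in the monomial `∏ z_k ^ d k`: the variable `x_i` occurs in `z_i` with
exponent `1` and in `z_{i+1}` with exponent `-1`, where indices are taken modulo `n`. -/
def xExponent {n : ℕ} [NeZero n] (d : Fin n →₀ ℕ) (i : Fin n) : ℤ :=
  (d i : ℤ) - (d (i + 1) : ℤ)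

/-- The `q`-shift operator `T_{q,x}^I = ∏_{i ∈ I} T_{q,x_i}`, where `T_{q,x_i}` replaces `x_i`
by `q x_i`. -/
def qShift {n : ℕ} [NeZero n] (q : ℂ) (I : Finset (Fin n)) (f : MvPowerSeries (Fin n) ℂ) :
    MvPowerSeries (Fin n) ℂ :=
  fun d => (∏ i ∈ I, q ^ xExponent d i) * MvPowerSeries.coeff d f

/-- The modified elliptic Ruijsenaars operator
`𝓔^{(r)}_{x,s}(p) = ∑_{|I| = r} s^I 𝓑_I(x; p) T_{q,x}^I`. -/
def modifiedOperator {n : ℕ} [NeZero n] (q t : ℂ) (s : Fin n → ℂ) (r : ℕ)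
    (f : MvPowerSeries (Fin n) ℂ) : MvPowerSeries (Fin n) ℂ :=
  ∑ I ∈ Finset.powersetCard r (Finset.univ : Finset (Fin n)),
    MvPowerSeries.C (∏ i ∈ I, s i) * coeffB t I * qShift q I f

/-- The embedding `ℂ⟦p⟧ → ℂ⟦p x₁/xₙ, x₂/x₁, …, xₙ/xₙ₋₁⟧`. -/
def ofNome {n : ℕ} (g : PowerSeries ℂ) : MvPowerSeries (Fin n) ℂ :=
  PowerSeries.subst (nome n) g

/-- The substitution in `ofNome` is an admissible one. -/
theorem hasSubst_nome (n : ℕ) [NeZero n] : PowerSeries.HasSubst (nome n) := by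
  apply PowerSeries.HasSubst.of_constantCoeff_zero
  simp [nome, map_prod, NeZero.ne n]

/-- `f` has leading term `1` and is a joint formal eigenfunction of the modified elliptic
Ruijsenaars operators, with formal eigenvalues `ε r ∈ ℂ⟦p⟧` for `r = 1, …, n`
(the values of `ε` at other `r` are irrelevant). -/
def IsFormalSolution {n : ℕ} [NeZero n] (q t : ℂ) (s : Fin n → ℂ)
    (f : MvPowerSeries (Fin n) ℂ) (ε : ℕ → PowerSeries ℂ) : Prop :=
  MvPowerSeries.constantCoeff f = 1 ∧
    ∀ r ∈ Finset.Icc 1 n, modifiedOperator q t s r f = ofNome (ε r) * f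

end

end Ruijsenaars

/-!
A theta identity, read off from partial fractions of elliptic functions, says that `𝓔^{(1)}`
commutes with every `𝓔^{(r)}`.  In the monomial basis `𝓔^{(1)}` is triangular, and for generic `s`
its diagonal entry at `1` recurs only at the powers of `p`.  Hence its eigenfunction `f` with
leading term `1` is unique up to `ℂ⟦p⟧`, every `𝓔^{(r)}` multiplies `f` by an element of `ℂ⟦p⟧`,
and all commutators of the family kill `f`.  The lowest coefficients of such a commutator
therefore satisfy a polynomial relation in `s` that holds for generic `s`, so they vanish, and the
family commutes for all `s`.

For the given `s`, the generating operator `∑ u ^ r 𝓔^{(r)}` has the diagonal entries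
`∏ (1 + s_i q^{e_i} u) - 1`, where `e_i` is the exponent of `x_i`.  The condition on `s` separates
them, as polynomials in `u`, from the entry at `1` away from the powers of `p`, and therefore also
their values at a suitable number `u`.  The eigenfunction of the generating operator at this `u` is
then a joint eigenfunction, because the family commutes.
-/

namespace Ruijsenaars

/-! ### Jacobi's theta series -/

section AdicLimits

theorem dvd_sub_sum_of_hasSum {A ι : Type*} [CommRing A] [TopologicalSpace A] [ContinuousSub A]
    {d a : A} {f : ι → A} (hd : IsClosed {x | d ∣ x}) (hf : HasSum f a) (S : Finset ι)
    (h : ∀ i ∉ S, d ∣ f i) : d ∣ a - ∑ i ∈ S, f i := by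
  classical
  refine (hd.preimage (continuous_sub_right (∑ i ∈ S, f i))).mem_of_tendsto hf ?_
  filter_upwards [Filter.eventually_ge_atTop S] with T hST
  rw [Set.mem_preimage, ← Finset.sum_sdiff hST, add_sub_cancel_right]
  exact Finset.dvd_sum fun i hi => h i (Finset.mem_sdiff.1 hi).2

theorem dvd_sub_prod_of_hasProd {A ι : Type*} [CommRing A] [TopologicalSpace A] [ContinuousSub A]
    {d a : A} {f : ι → A} (hd : IsClosed {x | d ∣ x}) (hf : HasProd f a) (S : Finset ι)
    (h : ∀ i ∉ S, d ∣ f i - 1) : d ∣ a - ∏ i ∈ S, f i := by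
  classical
  refine (hd.preimage (continuous_sub_right (∏ i ∈ S, f i))).mem_of_tendsto hf ?_
  filter_upwards [Filter.eventually_ge_atTop S] with T hST
  have hone : d ∣ ∏ i ∈ T \ S, f i - 1 := by
    simp_rw [← Ideal.mem_span_singleton, ← Ideal.Quotient.mk_eq_mk_iff_sub_mem, map_one,
      map_prod] at h ⊢
    exact Finset.prod_eq_one fun i hi => h i (Finset.mem_sdiff.1 hi).2
  rw [Set.mem_preimage, ← Finset.prod_sdiff hST]
  simpa [sub_mul] using hone.mul_right (∏ i ∈ S, f i)

open scoped MvPowerSeries.WithPiTopology in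
theorem isClosed_setOf_X_pow_dvd {σ R : Type*} [CommRing R] [TopologicalSpace R] [T1Space R]
    (i : σ) (N : ℕ) : IsClosed {f : MvPowerSeries σ R | MvPowerSeries.X i ^ N ∣ f} := by
  simp only [MvPowerSeries.X_pow_dvd_iff, Set.ofPred_forall]
  exact isClosed_iInter fun d => isClosed_iInter fun _ =>
    isClosed_singleton.preimage (MvPowerSeries.WithPiTopology.continuous_coeff R d)

end AdicLimits

section LaurentSum

open PowerSeries Filter

open scoped PowerSeries.WithPiTopology

variable {R : Type*} [CommRing R]

theorem eq_of_forall_X_pow_dvd_sub {f g : R⟦X⟧} (h : ∀ N : ℕ, (X : R⟦X⟧) ^ N ∣ f - g) :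
    f = g := by
  ext k
  simpa [sub_eq_zero] using X_pow_dvd_iff.1 (h (k + 1)) k (Nat.lt_succ_self k)

theorem tendsto_cofinite_atTop_of_abs_le {e : ℤ → ℕ} (he : ∀ m, |m| ≤ e m + 1) :
    Tendsto e cofinite atTop := by
  refine tendsto_atTop.2 fun N => eventually_cofinite.2 ?_
  refine (Set.finite_Icc (-(N : ℤ)) N).subset fun m hm => ?_
  have := abs_le.1 (he m)
  rw [Set.mem_ofPred_eq] at hm
  rw [Set.mem_Icc]
  omega

theorem tendsto_add_cofinite_atTop {ι κ : Type*} {e : ι → ℕ} {e' : κ → ℕ}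
    (he : Tendsto e cofinite atTop) (he' : Tendsto e' cofinite atTop) :
    Tendsto (fun x : ι × κ => e x.1 + e' x.2) cofinite atTop := by
  refine tendsto_atTop.2 fun N => eventually_cofinite.2 ?_
  refine ((eventually_cofinite.1 (tendsto_atTop.1 he N)).prod
    (eventually_cofinite.1 (tendsto_atTop.1 he' N))).subset fun x hx => ?_
  simp only [Set.mem_ofPred_eq, not_le, Set.mem_prod] at hx ⊢
  omega

variable [TopologicalSpace R]

theorem summable_C_mul_X_pow {ι : Type*} {e : ι → ℕ} (he : Tendsto e cofinite atTop) (w : ι → R) :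
    Summable fun i => C (w i) * (X : R⟦X⟧) ^ e i := by
  refine (PowerSeries.WithPiTopology.summable_iff_summable_coeff R).2 fun k =>
    summable_of_hasFiniteSupport ?_
  refine (eventually_cofinite.1 (tendsto_atTop.1 he (k + 1))).subset fun i hi => ?_
  rw [Function.mem_support, coeff_C_mul, coeff_X_pow, mul_ite, mul_zero, mul_one] at hi
  rw [Set.mem_ofPred_eq, (ite_ne_right_iff.1 hi).1]
  omega

theorem isClosed_setOf_powerSeries_X_pow_dvd [T1Space R] (N : ℕ) :
    IsClosed {f : R⟦X⟧ | X ^ N ∣ f} :=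
  isClosed_setOf_X_pow_dvd () N

theorem C_mul_tsum_C_mul_X_pow [IsTopologicalRing R] [T2Space R] {ι : Type*} {e : ι → ℕ}
    (he : Tendsto e cofinite atTop) (a : R) (w : ι → R) :
    C a * ∑' i, C (w i) * (X : R⟦X⟧) ^ e i = ∑' i, C (a * w i) * X ^ e i := by
  rw [← (summable_C_mul_X_pow he w).tsum_mul_left]
  simp only [map_mul, mul_assoc]

/-- The Laurent series `∑ m, u ^ m * X ^ e m` in a unit `u`, convergent if `e` tends to infinity
in both directions. -/
noncomputable def laurentSum (e : ℤ → ℕ) (u : Rˣ) : R⟦X⟧ :=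
  ∑' m : ℤ, C ((u ^ m : Rˣ) : R) * X ^ e m

variable [DiscreteTopology R]

theorem laurentSum_mul_laurentSum {e e' : ℤ → ℕ} (he : Tendsto e cofinite atTop)
    (he' : Tendsto e' cofinite atTop) (u v : Rˣ) :
    laurentSum e u * laurentSum e' v =
      ∑' x : ℤ × ℤ, C ((u ^ x.1 * v ^ x.2 : Rˣ) : R) * X ^ (e x.1 + e' x.2) := by
  have : RegularSpace R⟦X⟧ := inferInstanceAs (RegularSpace ((Unit →₀ ℕ) → R))
  have hterm : ∀ x : ℤ × ℤ,
      C ((u ^ x.1 * v ^ x.2 : Rˣ) : R) * (X : R⟦X⟧) ^ (e x.1 + e' x.2) =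
        (C ((u ^ x.1 : Rˣ) : R) * X ^ e x.1) * (C ((v ^ x.2 : Rˣ) : R) * X ^ e' x.2) := fun x => by
    rw [Units.val_mul, map_mul, pow_add, mul_mul_mul_comm]
  have hsum := summable_C_mul_X_pow (tendsto_add_cofinite_atTop he he')
    fun x : ℤ × ℤ => ((u ^ x.1 * v ^ x.2 : Rˣ) : R)
  rw [tsum_congr hterm]
  exact (summable_C_mul_X_pow he fun m => ((u ^ m : Rˣ) : R)).tsum_mul_tsum
    (summable_C_mul_X_pow he' fun m => ((v ^ m : Rˣ) : R)) (hsum.congr hterm)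

end LaurentSum

section JacobiTheta

open PowerSeries Filter

open scoped PowerSeries.WithPiTopology

/-- The triangular number `m (m - 1) / 2` of an integer `m`. -/
def tri (m : ℤ) : ℕ := (m * (m - 1) / 2).toNat

theorem two_mul_tri (m : ℤ) : 2 * (tri m : ℤ) = m * (m - 1) := by
  obtain ⟨k, hk⟩ : Even (m * (m - 1)) := Int.even_mul_pred_self m
  have hnonneg : 0 ≤ m * (m - 1) := by
    rcases le_or_gt m 0 with h | h
    · exact mul_nonneg_of_nonpos_of_nonpos h (by omega)
    · exact mul_nonneg h.le (by omega)
  rw [tri, hk]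
  omega

theorem tri_add_add_tri_sub (k c : ℤ) :
    tri (k + c) + tri (k - c) = 2 * tri k + c.natAbs ^ 2 := by
  zify
  linarith [two_mul_tri (k + c), two_mul_tri (k - c), two_mul_tri k, sq_abs c]

theorem tri_add_add_one_add_tri_sub (k c : ℤ) :
    tri (k + c + 1) + tri (k - c) = k.natAbs ^ 2 + 2 * tri (c + 1) := by
  zify
  linarith [two_mul_tri (k + c + 1), two_mul_tri (k - c), two_mul_tri (c + 1), sq_abs k]

theorem abs_le_tri_add_one (m : ℤ) : |m| ≤ tri m + 1 := by
  have h := two_mul_tri m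
  rcases abs_cases m with ⟨h1, h2⟩ | ⟨h1, h2⟩ <;> rw [h1] <;> nlinarith

theorem tendsto_tri : Tendsto tri cofinite atTop :=
  tendsto_cofinite_atTop_of_abs_le abs_le_tri_add_one

theorem tendsto_two_mul_tri : Tendsto (fun m => 2 * tri m) cofinite atTop :=
  tendsto_tri.const_mul_atTop' two_pos

theorem tendsto_natAbs_sq : Tendsto (fun m : ℤ => m.natAbs ^ 2) cofinite atTop :=
  tendsto_cofinite_atTop_of_abs_le fun m => by
    rw [Int.abs_eq_natAbs]
    exact_mod_cast (Nat.le_self_pow two_ne_zero m.natAbs).trans (Nat.le_succ _)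

/-- Pairs of integers, according to the parity of their difference. -/
def parityEquiv : (ℤ × ℤ) ⊕ (ℤ × ℤ) ≃ ℤ × ℤ where
  toFun := Sum.elim (fun x => (x.1 + x.2, x.1 - x.2)) fun x => (x.1 + x.2 + 1, x.1 - x.2)
  invFun y := if (y.1 - y.2) % 2 = 0 then Sum.inl ((y.1 + y.2) / 2, (y.1 - y.2) / 2)
    else Sum.inr ((y.1 + y.2 - 1) / 2, (y.1 - y.2 - 1) / 2)
  left_inv := by
    rintro (⟨k, c⟩ | ⟨k, c⟩)
    · have h : (k + c - (k - c)) % 2 = 0 := by omega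
      simp only [Sum.elim_inl, h, if_true, Sum.inl.injEq, Prod.mk.injEq]
      omega
    · have h : ¬ (k + c + 1 - (k - c)) % 2 = 0 := by omega
      simp only [Sum.elim_inr, h, if_false, Sum.inr.injEq, Prod.mk.injEq]
      omega
  right_inv := by
    rintro ⟨m, l⟩
    by_cases h : (m - l) % 2 = 0
    · simp only [h, if_true, Sum.elim_inl, Prod.mk.injEq]
      omega
    · simp only [h, if_false, Sum.elim_inr, Prod.mk.injEq]
      omega

theorem tsum_eq_tsum_add_tsum_parity {M : Type*} [AddCommMonoid M] [TopologicalSpace M]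
    [ContinuousAdd M] [T2Space M] {f : ℤ × ℤ → M}
    (heven : Summable fun x : ℤ × ℤ => f (x.1 + x.2, x.1 - x.2))
    (hodd : Summable fun x : ℤ × ℤ => f (x.1 + x.2 + 1, x.1 - x.2)) :
    ∑' x, f x =
      ∑' x : ℤ × ℤ, f (x.1 + x.2, x.1 - x.2) + ∑' x : ℤ × ℤ, f (x.1 + x.2 + 1, x.1 - x.2) :=
  (parityEquiv.tsum_eq f).symm.trans (Summable.tsum_sum heven hodd)

variable {R : Type*} [CommRing R] [TopologicalSpace R]

/-- The Jacobi theta series `∑ m, (-u) ^ m * X ^ (m * (m - 1) / 2)`. -/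
noncomputable def jacobi (u : Rˣ) : R⟦X⟧ := laurentSum tri (-u)

theorem X_pow_dvd_jacobi_sub_sum [DiscreteTopology R] (u : Rˣ) {N : ℕ} {S : Finset ℤ}
    (hS : ∀ m ∉ S, N ≤ tri m) :
    X ^ N ∣ jacobi u - ∑ m ∈ S, C (((-u) ^ m : Rˣ) : R) * X ^ tri m :=
  dvd_sub_sum_of_hasSum (isClosed_setOf_powerSeries_X_pow_dvd N)
    (summable_C_mul_X_pow tendsto_tri fun m => (((-u) ^ m : Rˣ) : R)).hasSum S
    fun m hm => (pow_dvd_pow X (hS m hm)).mul_left _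

theorem constantCoeff_jacobi [DiscreteTopology R] (u : Rˣ) :
    constantCoeff (jacobi u) = 1 - (u : R) := by
  have htri : ∀ m ∉ ({0, 1} : Finset ℤ), 1 ≤ tri m := fun m hm => by
    have h2 := two_mul_tri m
    have hm' : m * (m - 1) ≠ 0 := mul_ne_zero (by grind) (by grind)
    omega
  have h := X_pow_dvd_jacobi_sub_sum u htri
  rw [pow_one, X_dvd_iff, map_sub, sub_eq_zero] at h
  rw [h, Finset.sum_pair zero_ne_one, show tri 0 = 0 from rfl, show tri 1 = 0 from rfl]
  simp [sub_eq_add_neg]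

theorem jacobi_inv [DiscreteTopology R] (u : Rˣ) :
    jacobi u⁻¹ = -C ((u⁻¹ : Rˣ) : R) * jacobi u := by
  rw [jacobi, jacobi, laurentSum, laurentSum, ← (Equiv.subLeft (1 : ℤ)).tsum_eq,
    ← map_neg, C_mul_tsum_C_mul_X_pow tendsto_tri]
  refine tsum_congr fun m => ?_
  have htri : tri (1 - m) = tri m := by
    have h1 := two_mul_tri m
    have h2 := two_mul_tri (1 - m)
    zify
    linarith
  have hu : (-u⁻¹) ^ (1 - m) = -u⁻¹ * (-u) ^ m := by
    rw [zpow_sub, zpow_one, ← inv_zpow, inv_neg, inv_inv]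
  rw [Equiv.subLeft_apply, htri, hu, Units.val_mul, Units.val_neg]

theorem jacobi_mul_jacobi [DiscreteTopology R] (u v : Rˣ) :
    jacobi u * jacobi v =
      laurentSum (fun k => 2 * tri k) (u * v) * laurentSum (fun c => c.natAbs ^ 2) (u / v) -
        C (u : R) * (laurentSum (fun k => k.natAbs ^ 2) (u * v) *
          laurentSum (fun c => 2 * tri (c + 1)) (u / v)) := by
  have hshift : Tendsto (fun c => 2 * tri (c + 1)) cofinite atTop :=
    tendsto_two_mul_tri.comp (add_left_injective (1 : ℤ)).tendsto_cofinite
  have hpow : ∀ k c : ℤ, (-u) ^ (k + c) * (-v) ^ (k - c) = (u * v) ^ k * (u / v) ^ c :=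
    fun k c => by
      rw [zpow_add, zpow_sub, ← div_eq_mul_inv, mul_div_assoc', mul_right_comm, mul_div_assoc,
        ← mul_zpow, ← div_zpow, neg_mul_neg, neg_div_neg_eq]
  have hpow' : ∀ k c : ℤ,
      (-u) ^ (k + c + 1) * (-v) ^ (k - c) = -u * ((u * v) ^ k * (u / v) ^ c) := fun k c => by
    rw [zpow_add_one, mul_right_comm, hpow, mul_comm]
  have hEven : ∀ x : ℤ × ℤ,
      C (((-u) ^ (x.1 + x.2) * (-v) ^ (x.1 - x.2) : Rˣ) : R) *
          X ^ (tri (x.1 + x.2) + tri (x.1 - x.2)) =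
        C (((u * v) ^ x.1 * (u / v) ^ x.2 : Rˣ) : R) * X ^ (2 * tri x.1 + x.2.natAbs ^ 2) :=
    fun x => by rw [tri_add_add_tri_sub, hpow]
  have hOdd : ∀ x : ℤ × ℤ,
      C (((-u) ^ (x.1 + x.2 + 1) * (-v) ^ (x.1 - x.2) : Rˣ) : R) *
          X ^ (tri (x.1 + x.2 + 1) + tri (x.1 - x.2)) =
        C (-u * ((u * v) ^ x.1 * (u / v) ^ x.2 : Rˣ) : R) *
          X ^ (x.1.natAbs ^ 2 + 2 * tri (x.2 + 1)) :=
    fun x => by rw [tri_add_add_one_add_tri_sub, hpow', Units.val_mul, Units.val_neg]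
  have htend := tendsto_add_cofinite_atTop tendsto_two_mul_tri tendsto_natAbs_sq
  have htend' := tendsto_add_cofinite_atTop tendsto_natAbs_sq hshift
  rw [jacobi, jacobi, laurentSum_mul_laurentSum tendsto_tri tendsto_tri,
    laurentSum_mul_laurentSum tendsto_two_mul_tri tendsto_natAbs_sq,
    laurentSum_mul_laurentSum tendsto_natAbs_sq hshift, sub_eq_add_neg, ← neg_mul, ← map_neg,
    C_mul_tsum_C_mul_X_pow htend',
    tsum_eq_tsum_add_tsum_parity ((summable_C_mul_X_pow htend _).congr fun x => (hEven x).symm)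
      ((summable_C_mul_X_pow htend' _).congr fun x => (hOdd x).symm)]
  exact congrArg₂ _ (tsum_congr hEven) (tsum_congr hOdd)

end JacobiTheta

/-! ### The Jacobi triple product -/

section GaussBinomial

variable {A : Type*} [CommRing A]

/-- The Gaussian binomial coefficients in `p`. -/
def gaussBinom (p : A) : ℕ → ℕ → A
  | _, 0 => 1
  | 0, _ + 1 => 0
  | M + 1, j + 1 => gaussBinom p M j + p ^ (j + 1) * gaussBinom p M (j + 1)

theorem gaussBinom_zero_right (p : A) (M : ℕ) : gaussBinom p M 0 = 1 := by
  cases M <;> rfl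

theorem gaussBinom_succ_succ (p : A) (M j : ℕ) :
    gaussBinom p (M + 1) (j + 1) = gaussBinom p M j + p ^ (j + 1) * gaussBinom p M (j + 1) := rfl

theorem gaussBinom_eq_zero (p : A) {M j : ℕ} (h : M < j) : gaussBinom p M j = 0 := by
  induction M generalizing j with
  | zero =>
    obtain ⟨j, rfl⟩ := Nat.exists_eq_succ_of_ne_zero h.ne'
    rfl
  | succ M ih =>
    obtain ⟨j, rfl⟩ := Nat.exists_eq_succ_of_ne_zero (Nat.ne_zero_of_lt h)
    rw [Nat.succ_eq_add_one, gaussBinom_succ_succ, ih (by omega), ih (by omega), mul_zero, add_zero]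

theorem gaussBinom_self (p : A) (M : ℕ) : gaussBinom p M M = 1 := by
  induction M with
  | zero => rfl
  | succ M ih =>
    rw [gaussBinom_succ_succ, ih, gaussBinom_eq_zero p (Nat.lt_succ_self M), mul_zero, add_zero]

theorem prod_add_pow_mul (p y w : A) (M : ℕ) :
    ∏ k ∈ Finset.range M, (y + p ^ k * w) =
      ∑ j ∈ Finset.range (M + 1), p ^ j.choose 2 * gaussBinom p M j * w ^ j * y ^ (M - j) := by
  induction M generalizing w with
  | zero => simp [gaussBinom_zero_right]
  | succ M ih =>
    set g : ℕ → A := fun j =>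
      p ^ j.choose 2 * (p ^ j * gaussBinom p M j) * w ^ j * y ^ (M + 1 - j) with hg
    have hshift : ∏ k ∈ Finset.range M, (y + p ^ (k + 1) * w) =
        ∏ k ∈ Finset.range M, (y + p ^ k * (p * w)) :=
      Finset.prod_congr rfl fun k _ => by ring
    have hmul_y : ∑ j ∈ Finset.range (M + 1),
        p ^ j.choose 2 * gaussBinom p M j * (p * w) ^ j * y ^ (M - j) * y =
        ∑ j ∈ Finset.range (M + 1), g (j + 1) + g 0 := by
      have hg_succ : g (M + 1) = 0 := by simp [hg, gaussBinom_eq_zero p (Nat.lt_succ_self M)]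
      rw [← Finset.sum_range_succ', Finset.sum_range_succ _ (M + 1), hg_succ, add_zero]
      refine Finset.sum_congr rfl fun j hj => ?_
      simp only [hg, Nat.sub_add_comm (Nat.lt_succ_iff.1 (Finset.mem_range.1 hj))]
      ring
    rw [Finset.prod_range_succ', hshift, ih, Finset.sum_range_succ' _ (M + 1), pow_zero, one_mul,
      mul_add, Finset.sum_mul, Finset.sum_mul, hmul_y, add_right_comm, ← Finset.sum_add_distrib]
    congr 1
    · refine Finset.sum_congr rfl fun j _ => ?_
      simp only [hg, gaussBinom_succ_succ, Nat.choose_succ_succ' j 1, Nat.choose_one_right,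
        Nat.add_sub_add_right]
      ring
    · simp [hg, gaussBinom_zero_right]

/-- The finite shifted factorial `(p; p)_m`. -/
def eulerProd (p : A) (m : ℕ) : A := ∏ k ∈ Finset.range m, (1 - p ^ k * p)

theorem eulerProd_succ (p : A) (m : ℕ) :
    eulerProd p (m + 1) = eulerProd p m * (1 - p ^ (m + 1)) := by
  rw [eulerProd, Finset.prod_range_succ, eulerProd, pow_succ]

theorem gaussBinom_mul_eulerProd (p : A) : ∀ i j : ℕ,
    gaussBinom p (i + j) j * (eulerProd p j * eulerProd p i) = eulerProd p (i + j)
  | i, 0 => by simp [gaussBinom_zero_right, eulerProd]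
  | 0, j + 1 => by simp [gaussBinom_self, eulerProd]
  | i + 1, j + 1 => by
    have hleft := gaussBinom_mul_eulerProd p (i + 1) j
    have hright := gaussBinom_mul_eulerProd p i (j + 1)
    rw [show i + (j + 1) = i + 1 + j by omega] at hright
    rw [eulerProd_succ p j] at hright ⊢
    rw [eulerProd_succ p i] at hleft ⊢
    rw [← add_assoc, gaussBinom_succ_succ, eulerProd_succ p (i + 1 + j)]
    linear_combination (1 - p ^ (j + 1)) * hleft + p ^ (j + 1) * (1 - p ^ (i + 1)) * hright

theorem prod_pow_add_pow_add_mul (p w : A) (N : ℕ) :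
    ∏ k ∈ Finset.range N, (p ^ N + p ^ (N + k) * w) =
      p ^ (N * N) * ∏ k ∈ Finset.range N, (1 + p ^ k * w) := by
  simp_rw [show ∀ k, p ^ N + p ^ (N + k) * w = p ^ N * (1 + p ^ k * w) from fun k => by ring]
  rw [Finset.prod_mul_distrib, Finset.prod_const, Finset.card_range, pow_mul]

theorem prod_pow_add_pow_mul (p : A) (w : Aˣ) (N : ℕ) :
    ∏ k ∈ Finset.range N, (p ^ N + p ^ k * w) =
      (w : A) ^ N * p ^ N.choose 2 * ∏ k ∈ Finset.range N, (1 + p ^ k * (p * ↑w⁻¹)) := by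
  have hfactor : ∀ k ∈ Finset.range N, p ^ N + p ^ k * w =
      w * p ^ k * (1 + p ^ (N - 1 - k) * (p * ↑w⁻¹)) := fun k hk => by
    have hp : p ^ N = p ^ k * p ^ (N - 1 - k) * p := by
      have hk := Finset.mem_range.1 hk
      rw [← pow_add, ← pow_succ]
      congr 1
      omega
    rw [hp]
    linear_combination (-p ^ k * p ^ (N - 1 - k) * p) * w.mul_inv
  rw [Finset.prod_congr rfl hfactor, Finset.prod_mul_distrib, Finset.prod_mul_distrib,
    Finset.prod_const, Finset.card_range, Finset.prod_pow_eq_pow_sum, Finset.sum_range_id,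
    Nat.choose_two_right, Finset.prod_range_reflect (fun k => 1 + p ^ k * (p * ↑w⁻¹))]

theorem choose_two_add_mul_sub {N j : ℕ} (hj : j ≤ 2 * N) :
    j.choose 2 + N * (2 * N - j) = N.choose 2 + N * N + tri (j - N) := by
  have hchoose : ∀ k : ℕ, 2 * (k.choose 2 : ℤ) = k * (k - 1) := fun k => by
    have h := Nat.cast_choose_two ℚ k
    rw [eq_div_iff two_ne_zero] at h
    rw [mul_comm]
    exact_mod_cast h
  zify [hj]
  linarith [hchoose j, hchoose N, two_mul_tri (j - N)]

theorem prod_one_add_mul_prod_one_add_inv {p : A} (hp : IsLeftRegular p) (w : Aˣ) (N : ℕ) :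
    (∏ k ∈ Finset.range N, (1 + p ^ k * w)) * ∏ k ∈ Finset.range N, (1 + p ^ k * (p * ↑w⁻¹)) =
      ∑ j ∈ Finset.range (2 * N + 1),
        gaussBinom p (2 * N) j * (((w ^ (j - N : ℤ) : Aˣ) : A) * p ^ tri (j - N)) := by
  have hbinom := prod_add_pow_mul p (p ^ N) w (2 * N)
  rw [two_mul, Finset.prod_range_add, ← two_mul, prod_pow_add_pow_add_mul,
    prod_pow_add_pow_mul] at hbinom
  have hreg : IsLeftRegular ((w : A) ^ N * p ^ (N.choose 2 + N * N)) :=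
    ((w.isUnit.pow N).isRegular.left).mul (hp.pow _)
  refine hreg ?_
  dsimp only
  rw [pow_add, Finset.mul_sum]
  refine Eq.trans (by ring) (hbinom.trans (Finset.sum_congr rfl fun j hj => ?_))
  have hpow_w : (w : A) ^ j = w ^ N * ((w ^ (j - N : ℤ) : Aˣ) : A) := by
    rw [← Units.val_pow_eq_pow_val, ← Units.val_pow_eq_pow_val, ← Units.val_mul, ← zpow_natCast,
      ← zpow_natCast, ← zpow_add, add_sub_cancel]
  have hpow_p : p ^ j.choose 2 * (p ^ N) ^ (2 * N - j) =
      p ^ N.choose 2 * p ^ (N * N) * p ^ tri (j - N) := by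
    rw [← pow_mul, ← pow_add, ← pow_add, ← pow_add,
      choose_two_add_mul_sub (Nat.lt_succ_iff.1 (Finset.mem_range.1 hj))]
  rw [hpow_w]
  linear_combination (gaussBinom p (2 * N) j * w ^ N * ((w ^ (j - N : ℤ) : Aˣ) : A)) * hpow_p

end GaussBinomial

section TripleProduct

open PowerSeries Filter

open scoped PowerSeries.WithPiTopology

variable {R : Type*} [CommRing R] [TopologicalSpace R]

/-- The shifted factorial `(a; X)_∞` of a formal power series `a` in one variable. -/
noncomputable def shiftedFactorial (a : R⟦X⟧) : R⟦X⟧ := ∏' k : ℕ, (1 - X ^ k * a)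

theorem multipliable_shiftedFactorial (a : R⟦X⟧) : Multipliable fun k : ℕ => 1 - X ^ k * a := by
  simp_rw [sub_eq_add_neg]
  refine PowerSeries.WithPiTopology.multipliable_one_add_of_tendsto_order_atTop_nhds_top R ?_
  refine tendsto_of_tendsto_of_tendsto_of_le_of_le (g := fun k : ℕ => (k : ℕ∞))
    ENat.tendsto_natCast_nhds_top tendsto_const_nhds (fun k => ?_) fun k => le_top
  exact nat_le_order _ k fun i hi => by
    rw [map_neg, coeff_X_pow_mul', if_neg hi.not_ge, neg_zero]

variable [DiscreteTopology R]

theorem X_pow_dvd_shiftedFactorial_sub_prod {a : R⟦X⟧} {d : ℕ} (ha : X ^ d ∣ a) (N : ℕ) :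
    X ^ (N + d) ∣ shiftedFactorial a - ∏ k ∈ Finset.range N, (1 - X ^ k * a) := by
  refine dvd_sub_prod_of_hasProd (isClosed_setOf_powerSeries_X_pow_dvd _)
    (multipliable_shiftedFactorial a).hasProd _ fun k hk => ?_
  rw [sub_sub_cancel_left, dvd_neg, pow_add]
  exact mul_dvd_mul (pow_dvd_pow X (by simpa using hk)) ha

theorem isUnit_shiftedFactorial_X : IsUnit (shiftedFactorial (X : R⟦X⟧)) := by
  have h : (X : R⟦X⟧) ^ (0 + 1) ∣ shiftedFactorial X - ∏ k ∈ Finset.range 0, (1 - X ^ k * X) :=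
    X_pow_dvd_shiftedFactorial_sub_prod (by rw [pow_one]) 0
  rw [zero_add, pow_one, X_dvd_iff, Finset.prod_range_zero, map_sub, sub_eq_zero, map_one] at h
  exact isUnit_iff_constantCoeff.2 (h ▸ isUnit_one)

theorem X_pow_dvd_shiftedFactorial_mul_gaussBinom_sub_one (i j : ℕ) :
    (X : R⟦X⟧) ^ (min i j + 1) ∣ shiftedFactorial X * gaussBinom X (i + j) j - 1 := by
  have hX : (X : R⟦X⟧) ^ 1 ∣ X := by rw [pow_one]
  have heuler : ∀ m, min i j ≤ m →
      (X : R⟦X⟧) ^ (min i j + 1) ∣ shiftedFactorial X - eulerProd X m := fun m hm =>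
    (pow_dvd_pow X (Nat.succ_le_succ hm)).trans
      (X_pow_dvd_shiftedFactorial_sub_prod hX m)
  have hj := heuler j (min_le_right i j)
  have hi := heuler i (min_le_left i j)
  have hij := heuler (i + j) ((min_le_left i j).trans (Nat.le_add_right i j))
  rw [← isUnit_shiftedFactorial_X.dvd_mul_right]
  convert dvd_sub (((hj.mul_right (shiftedFactorial X)).add
    (hi.mul_left (eulerProd X j))).mul_right (gaussBinom X (i + j) j)) hij using 1
  linear_combination gaussBinom_mul_eulerProd (X : R⟦X⟧) i j

theorem X_pow_dvd_jacobi_sub_sum_range (u : Rˣ) (N : ℕ) :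
    X ^ N ∣ jacobi u - ∑ j ∈ Finset.range (2 * N + 1),
      C (((-u) ^ (j - N : ℤ) : Rˣ) : R) * X ^ tri (j - N) := by
  have h := X_pow_dvd_jacobi_sub_sum u (N := N)
    (S := (Finset.range (2 * N + 1)).image fun j : ℕ => (j - N : ℤ)) fun m hm => ?_
  · rwa [Finset.sum_image fun a _ b _ hab => by simpa using hab] at h
  · contrapose! hm
    have htri := abs_le.1 (abs_le_tri_add_one m)
    exact Finset.mem_image.2 ⟨(m + N).toNat, Finset.mem_range.2 (by omega), by omega⟩

theorem X_pow_dvd_shiftedFactorial_mul_sum_sub_jacobi (u : Rˣ) (N : ℕ) :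
    X ^ N ∣ shiftedFactorial X * (∑ j ∈ Finset.range (2 * N + 1),
      gaussBinom X (2 * N) j * (C (((-u) ^ (j - N : ℤ) : Rˣ) : R) * X ^ tri (j - N))) -
        jacobi u := by
  have hterm : X ^ N ∣ ∑ j ∈ Finset.range (2 * N + 1),
      (shiftedFactorial X * gaussBinom X (2 * N) j - 1) *
        (C (((-u) ^ (j - N : ℤ) : Rˣ) : R) * X ^ tri (j - N)) := by
    refine Finset.dvd_sum fun j hj => ?_
    obtain ⟨i, hi⟩ := Nat.exists_eq_add_of_le' (Nat.lt_succ_iff.1 (Finset.mem_range.1 hj))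
    have hle : N ≤ min i j + 1 + tri (j - N) := by
      have htri := abs_le.1 (abs_le_tri_add_one (j - N))
      omega
    rw [hi]
    refine (pow_dvd_pow X hle).trans ?_
    rw [pow_add]
    exact mul_dvd_mul (X_pow_dvd_shiftedFactorial_mul_gaussBinom_sub_one i j)
      (Dvd.intro_left _ rfl)
  convert dvd_sub hterm (X_pow_dvd_jacobi_sub_sum_range u N) using 1
  simp only [sub_mul, Finset.sum_sub_distrib, one_mul, Finset.mul_sum, mul_assoc]
  ring

theorem jacobi_triple_product (u : Rˣ) :
    shiftedFactorial X * (shiftedFactorial (C (u : R)) *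
      shiftedFactorial (X * C ((u⁻¹ : Rˣ) : R))) = jacobi u := by
  refine eq_of_forall_X_pow_dvd_sub fun N => ?_
  have hfinite := prod_one_add_mul_prod_one_add_inv
    (p := (X : R⟦X⟧)) (fun f g h => X_mul_cancel h) (Units.map (C : R →+* R⟦X⟧) (-u)) N
  simp only [← map_inv, ← map_zpow, Units.coe_map, MonoidHom.coe_coe, inv_neg, Units.val_neg,
    map_neg, mul_neg, ← sub_eq_add_neg] at hfinite
  have hprod : ∀ a : R⟦X⟧,
      X ^ N ∣ shiftedFactorial a - ∏ k ∈ Finset.range N, (1 - X ^ k * a) := fun a =>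
    X_pow_dvd_shiftedFactorial_sub_prod (d := 0) (by rw [pow_zero]; exact one_dvd a) N
  have hsum := X_pow_dvd_shiftedFactorial_mul_sum_sub_jacobi u N
  rw [← hfinite] at hsum
  convert (((hprod (C (u : R))).mul_right (shiftedFactorial (X * C ((u⁻¹ : Rˣ) : R)))).add
    ((hprod (X * C ((u⁻¹ : Rˣ) : R))).mul_left
      (∏ k ∈ Finset.range N, (1 - X ^ k * C (u : R))))).mul_left (shiftedFactorial X) |>.add
    hsum using 1
  ring

theorem jacobi_eq_zero_iff {u : Rˣ} : jacobi u = 0 ↔ u = 1 := by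
  refine ⟨fun h => ?_, ?_⟩
  · have hconst := constantCoeff_jacobi u
    rw [h, map_zero] at hconst
    exact Units.ext (sub_eq_zero.1 hconst.symm).symm
  · rintro rfl
    have hzero : shiftedFactorial (C ((1 : Rˣ) : R)) = 0 :=
      tprod_of_exists_eq_zero ⟨0, by simp⟩
    rw [← jacobi_triple_product, hzero, zero_mul, mul_zero]

end TripleProduct

/-! ### Partial fractions of theta functions -/

section PartialFraction

variable {G K ι : Type*} [CommGroup G] [Field K]

theorem exists_eq_cons_of_card_pos {s : Multiset ι} (hs : 0 < s.card) :
    ∃ a s', s = a ::ₘ s' :=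
  (Multiset.card_pos_iff_exists_mem.1 hs).imp fun _ ha => Multiset.exists_cons_of_mem ha

theorem exists_eq_cons_cons_of_two_le_card {s : Multiset ι} (hs : 2 ≤ s.card) :
    ∃ a b s', s = a ::ₘ b ::ₘ s' := by
  obtain ⟨a, s, rfl⟩ := exists_eq_cons_of_card_pos (two_pos.trans_le hs)
  rw [Multiset.card_cons] at hs
  obtain ⟨b, s, rfl⟩ := exists_eq_cons_of_card_pos (Nat.le_of_succ_le_succ hs)
  exact ⟨a, b, s, rfl⟩

theorem exists_mul_ne_of_two_lt_card {a : ι → G} {S : Finset ι} (ha : Set.InjOn a S)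
    (hS : 2 < S.card) (c : G) : ∃ k ∈ S, ∃ l ∈ S, k ≠ l ∧ a k * a l ≠ c := by
  obtain ⟨i, hi, j, hj, k, hk, hij, hik, hjk⟩ := Finset.two_lt_card.1 hS
  by_cases h : a i * a j = c
  · exact ⟨i, hi, k, hk, hik, fun h' => hjk (ha hj hk (mul_left_cancel (h.trans h'.symm)))⟩
  · exact ⟨i, hi, j, hj, hij, h⟩

/-- The properties of a theta function on a group on which elliptic partial fractions rest:
it vanishes only at `1`, it is quasi-symmetric under inversion, and the functions
`a ↦ θ (a / b₁) θ (a / b₂)` with a given product `b₁ b₂` span a space of dimension at most two. -/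
structure IsTheta (χ : G →* Kˣ) (th : G → K) : Prop where
  eq_zero_iff : ∀ u, th u = 0 ↔ u = 1
  map_inv : ∀ u, th u⁻¹ = -χ u⁻¹ * th u
  exists_span : ∀ B : G, ∃ e₀ e₁ : G → K, ∀ b₁ b₂, b₁ * b₂ = B →
    ∃ l m : K, ∀ a, th (a / b₁) * th (a / b₂) = l * e₀ a + m * e₁ a

namespace IsTheta

variable {χ : G →* Kˣ} {th : G → K} (h : IsTheta χ th)

include h

theorem map_one : th 1 = 0 := (h.eq_zero_iff 1).2 rfl

theorem ne_zero {u : G} (hu : u ≠ 1) : th u ≠ 0 := fun h0 => hu ((h.eq_zero_iff u).1 h0)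

theorem div_ne_zero {a b : G} (hab : a ≠ b) : th (a / b) ≠ 0 :=
  h.ne_zero fun h1 => hab (div_eq_one.1 h1)

theorem exists_addition {a₁ a₂ b₁ b₂ : G} (ha : a₁ ≠ a₂) (hab : a₁ * a₂ ≠ b₁ * b₂) :
    ∃ α β : K, ∀ x, th (x / b₁) * th (x / b₂) =
      α * (th (x / a₁) * th (x / (b₁ * b₂ / a₁))) +
        β * (th (x / a₂) * th (x / (b₁ * b₂ / a₂))) := by
  obtain ⟨e₀, e₁, he⟩ := h.exists_span (b₁ * b₂)
  obtain ⟨l, m, hb⟩ := he b₁ b₂ rfl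
  obtain ⟨l₁, m₁, h₁⟩ := he a₁ (b₁ * b₂ / a₁) (mul_div_cancel _ _)
  obtain ⟨l₂, m₂, h₂⟩ := he a₂ (b₁ * b₂ / a₂) (mul_div_cancel _ _)
  have hzero : l₁ * e₀ a₁ + m₁ * e₁ a₁ = 0 := by rw [← h₁, div_self', h.map_one, zero_mul]
  have hne₁ : l₂ * e₀ a₁ + m₂ * e₁ a₁ ≠ 0 := by
    rw [← h₂]
    exact mul_ne_zero (h.div_ne_zero ha)
      (h.div_ne_zero fun h0 => hab (eq_div_iff_mul_eq'.1 h0))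
  have hne₂ : l₁ * e₀ a₂ + m₁ * e₁ a₂ ≠ 0 := by
    rw [← h₁]
    exact mul_ne_zero (h.div_ne_zero ha.symm)
      (h.div_ne_zero fun h0 => hab ((mul_comm _ _).trans (eq_div_iff_mul_eq'.1 h0)))
  have hdet : l₁ * m₂ - l₂ * m₁ ≠ 0 := fun h0 => by
    refine mul_ne_zero hne₁ hne₂ ?_
    linear_combination (e₀ a₂ * l₂ + m₂ * e₁ a₂) * hzero + (e₀ a₂ * e₁ a₁ - e₀ a₁ * e₁ a₂) * h0
  refine ⟨(l * m₂ - m * l₂) / (l₁ * m₂ - l₂ * m₁), (l₁ * m - m₁ * l) / (l₁ * m₂ - l₂ * m₁),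
    fun x => ?_⟩
  rw [hb, h₁, h₂, div_mul_eq_mul_div, div_mul_eq_mul_div, ← add_div, eq_div_iff hdet]
  ring

theorem div_add_div_eq_zero {a₁ a₂ b₁ b₂ : G} (ha : a₁ ≠ a₂) (hab : b₁ * b₂ = a₁ * a₂) :
    th (a₁ / b₁) * th (a₁ / b₂) / th (a₁ / a₂) +
      th (a₂ / b₁) * th (a₂ / b₂) / th (a₂ / a₁) = 0 := by
  have hinv₁ : a₂ / b₁ = (a₁ / b₂)⁻¹ := by
    rw [inv_div, div_eq_div_iff_mul_eq_mul, mul_comm a₂, ← hab, mul_comm]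
  have hinv₂ : a₂ / b₂ = (a₁ / b₁)⁻¹ := by
    rw [inv_div, div_eq_div_iff_mul_eq_mul, mul_comm a₂, ← hab]
  have hχ : (χ (a₁ / b₂)⁻¹ : K) * χ (a₁ / b₁)⁻¹ = χ (a₁ / a₂)⁻¹ := by
    rw [← Units.val_mul, ← _root_.map_mul, inv_div, inv_div, inv_div, div_mul_div_comm,
      mul_comm b₂, hab, mul_div_mul_left_eq_div]
  have hth := h.div_ne_zero ha
  have hunit := (χ (a₁ / a₂)⁻¹).ne_zero
  rw [hinv₁, hinv₂, ← inv_div a₁ a₂, h.map_inv, h.map_inv, h.map_inv]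
  field_simp
  linear_combination (-th (a₁ / b₁) * th (a₁ / b₂)) * hχ

theorem sum_mul_div_prod_erase [DecidableEq ι] {a : ι → G} {S : Finset ι} (ha : Set.InjOn a S)
    {m : ι} (hm : m ∈ S) (F : ι → K) :
    ∑ i ∈ S, th (a i / a m) * F i / ∏ j ∈ S.erase i, th (a i / a j) =
      ∑ i ∈ S.erase m, F i / ∏ j ∈ (S.erase m).erase i, th (a i / a j) := by
  rw [← Finset.add_sum_erase S _ hm, div_self', h.map_one, zero_mul, zero_div, zero_add]
  refine Finset.sum_congr rfl fun i hi => ?_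
  obtain ⟨him, hiS⟩ := Finset.mem_erase.1 hi
  rw [Finset.erase_right_comm, ← Finset.mul_prod_erase (S.erase i) (fun j => th (a i / a j))
    (Finset.mem_erase.2 ⟨him.symm, hm⟩),
    mul_div_mul_left _ _ (h.div_ne_zero fun h0 => him (ha hiS hm h0))]

theorem sum_div_prod_erase_eq_zero [DecidableEq ι] (a : ι → G) (S : Finset ι)
    (ha : Set.InjOn a S) (B : Multiset G) (hB : B.card = S.card) (hS : 2 ≤ S.card)
    (hprod : B.prod = ∏ i ∈ S, a i) :
    ∑ i ∈ S, (B.map fun b => th (a i / b)).prod / ∏ j ∈ S.erase i, th (a i / a j) = 0 := by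
  obtain ⟨N, hN⟩ := Nat.exists_eq_add_of_le' hS
  obtain ⟨b₁, b₂, B, rfl⟩ := exists_eq_cons_cons_of_two_le_card (hB.symm ▸ hS)
  simp only [Multiset.card_cons, Multiset.map_cons, Multiset.prod_cons] at hB hprod ⊢
  induction N generalizing S b₁ b₂ B with
  | zero =>
    obtain ⟨i, j, hij, rfl⟩ := Finset.card_eq_two.1 hN
    obtain rfl : B = 0 := Multiset.card_eq_zero.1 (by omega)
    rw [Finset.prod_pair hij] at hprod
    simpa [Finset.sum_pair hij, Finset.erase_insert_of_ne hij, hij] using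
      h.div_add_div_eq_zero (fun h0 => hij (ha (by simp) (by simp) h0)) (by simpa using hprod)
  | succ N ih =>
    obtain ⟨k, hk, l, hl, hkl, hne⟩ :=
      exists_mul_ne_of_two_lt_card ha (by omega : 2 < S.card) (b₁ * b₂)
    obtain ⟨α, β, hαβ⟩ := h.exists_addition (fun h0 => hkl (ha hk hl h0)) hne
    obtain ⟨b₃, B, rfl⟩ := exists_eq_cons_of_card_pos (by omega : 0 < B.card)
    simp only [Multiset.card_cons, Multiset.map_cons, Multiset.prod_cons] at hB hprod ⊢
    have hsum : ∀ m ∈ S, ∑ i ∈ S, th (a i / a m) * (th (a i / (b₁ * b₂ / a m)) *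
        (th (a i / b₃) * (B.map fun b => th (a i / b)).prod)) /
          ∏ j ∈ S.erase i, th (a i / a j) = 0 := fun m hm => by
      have hcard := Finset.card_erase_of_mem hm
      rw [h.sum_mul_div_prod_erase ha hm]
      refine ih (S.erase m) (ha.mono (Finset.erase_subset m S)) (by omega) (by omega) _ _ _
        (by omega) (mul_left_cancel (a := a m) ?_)
      rw [Finset.mul_prod_erase S a hm, ← hprod, ← mul_assoc, mul_div_cancel, mul_assoc]
    have hsplit : ∀ (i : ι) (F D : K), th (a i / b₁) * (th (a i / b₂) * F) / D =
        α * (th (a i / a k) * (th (a i / (b₁ * b₂ / a k)) * F) / D) +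
          β * (th (a i / a l) * (th (a i / (b₁ * b₂ / a l)) * F) / D) := fun i F D => by
      rw [← mul_assoc, hαβ]
      ring
    simp only [hsplit, Finset.sum_add_distrib, ← Finset.mul_sum, hsum k hk, hsum l hl, mul_zero,
      add_zero]

end IsTheta

/-- The elliptic function `θ (t v) θ (q v / t) / (θ v θ (q v))` entering the commutation relations
of the elliptic Ruijsenaars operators. -/
def thetaQuotient (th : G → K) (q t v : G) : K :=
  th (t * v) * th (q / t * v) / (th v * th (q * v))

theorem thetaQuotient_eq_one {th : G → K} {q t v : G} (ht : t = 1 ∨ t = q) (hv : th v ≠ 0)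
    (hqv : th (q * v) ≠ 0) : thetaQuotient th q t v = 1 := by
  rw [thetaQuotient, div_eq_one_iff_eq (mul_ne_zero hv hqv)]
  rcases ht with rfl | rfl
  · rw [one_mul, div_one]
  · rw [div_self', one_mul, mul_comm]

theorem prod_mul_prod_div_prod_erase_mul_prod [DecidableEq ι] {D : Finset ι} {i : ι} (hi : i ∈ D)
    (f g u v : ι → K) :
    (∏ j ∈ D, f j) * (∏ j ∈ D, g j) / ((∏ j ∈ D.erase i, u j) * ∏ j ∈ D, v j) =
      f i * g i / v i * ∏ j ∈ D.erase i, f j * g j / (u j * v j) := by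
  rw [← Finset.mul_prod_erase D f hi, ← Finset.mul_prod_erase D g hi,
    ← Finset.mul_prod_erase D v hi, Finset.prod_div_distrib, Finset.prod_mul_distrib,
    Finset.prod_mul_distrib, div_mul_div_comm]
  congr 1 <;> ring

theorem prod_disjSum_erase_inl [DecidableEq ι] (D : Finset ι) (i : ι) (f : ι ⊕ ι → K) :
    ∏ j ∈ (D.disjSum D).erase (Sum.inl i), f j =
      (∏ j ∈ D.erase i, f (Sum.inl j)) * ∏ j ∈ D, f (Sum.inr j) := by
  rw [← Finset.prod_disjSum]
  congr 1
  ext (k | k) <;> simp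

theorem prod_disjSum_erase_inr [DecidableEq ι] (D : Finset ι) (i : ι) (f : ι ⊕ ι → K) :
    ∏ j ∈ (D.disjSum D).erase (Sum.inr i), f j =
      (∏ j ∈ D.erase i, f (Sum.inr j)) * ∏ j ∈ D, f (Sum.inl j) := by
  rw [mul_comm, ← Finset.prod_disjSum]
  congr 1
  ext (k | k) <;> simp

theorem residue_inl [DecidableEq ι] (th : G → K) (q t : G) (x : ι → G) {D : Finset ι} {i : ι}
    (hi : i ∈ D) :
    (∏ j ∈ D, th (x i / (x j / t))) * (∏ j ∈ D, th (x i / (t / q * x j))) /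
        ((∏ j ∈ D.erase i, th (x i / x j)) * ∏ j ∈ D, th (x i / (x j / q))) =
      th t * th (q / t) / th q * ∏ j ∈ D.erase i, thetaQuotient th q t (x i / x j) := by
  have e₁ (s y : G) : x i / (y / s) = s * (x i / y) := by
    rw [div_div_eq_mul_div, mul_comm, mul_div_assoc]
  have e₂ (y : G) : x i / (t / q * y) = q / t * (x i / y) := by
    rw [div_mul_eq_div_div_swap, div_div_eq_mul_div, mul_comm _ q, ← mul_div_right_comm]
  simp only [e₁, e₂]
  rw [prod_mul_prod_div_prod_erase_mul_prod hi, div_self', mul_one, mul_one, mul_one]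
  rfl

theorem injOn_sumElim_div {q : G} {x : ι → G} {D : Finset ι} (hx : Set.InjOn x D)
    (hqx : ∀ i ∈ D, ∀ j ∈ D, q * x i ≠ x j) :
    Set.InjOn (Sum.elim x fun i => x i / q) (D.disjSum D) := by
  rintro (i | i) hi (j | j) hj hij <;>
    simp only [Finset.mem_coe, Finset.inl_mem_disjSum, Finset.inr_mem_disjSum] at hi hj <;>
    simp only [Sum.elim_inl, Sum.elim_inr] at hij
  · rw [hx hi hj hij]
  · exact absurd (by rw [hij, mul_div_cancel]) (hqx i hi j hj)
  · exact absurd (by rw [← hij, mul_div_cancel]) (hqx j hj i hi)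
  · rw [hx hi hj (div_left_injective hij)]

namespace IsTheta

variable {χ : G →* Kˣ} {th : G → K} (h : IsTheta χ th)

include h

theorem thetaQuotient_inv (q t v : G) :
    th (q / t * v)⁻¹ * th (t * v)⁻¹ / (th v⁻¹ * th (q * v)⁻¹) = thetaQuotient th q t v := by
  have hχ : (χ (q / t * v)⁻¹ : K) * χ (t * v)⁻¹ = χ v⁻¹ * χ (q * v)⁻¹ := by
    rw [← Units.val_mul, ← Units.val_mul, ← map_mul, ← map_mul, ← mul_inv, ← mul_inv,
      mul_mul_mul_comm, div_mul_cancel, mul_left_comm v]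
  have hunit := mul_ne_zero (χ v⁻¹).ne_zero (χ (q * v)⁻¹).ne_zero
  rw [h.map_inv, h.map_inv, h.map_inv, h.map_inv, thetaQuotient, mul_mul_mul_comm,
    mul_mul_mul_comm (-(χ v⁻¹ : K)), neg_mul_neg, neg_mul_neg, hχ, mul_div_mul_left _ _ hunit,
    mul_comm (th (q / t * v))]

theorem inv_mul_inv_div_inv {q : G} (hq : q ≠ 1) (t : G) :
    th (q / t)⁻¹ * th t⁻¹ / th q⁻¹ = -(th t * th (q / t) / th q) := by
  have hχ : (χ (q / t)⁻¹ : K) * χ t⁻¹ = χ q⁻¹ := by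
    rw [← Units.val_mul, ← map_mul, ← mul_inv, div_mul_cancel]
  have hth := h.ne_zero hq
  have hunit := (χ q⁻¹).ne_zero
  rw [h.map_inv, h.map_inv, h.map_inv]
  field_simp
  linear_combination (-th t * th (q / t)) * hχ

theorem residue_inr [DecidableEq ι] {q : G} (hq : q ≠ 1) (t : G) (x : ι → G) {D : Finset ι} {i : ι}
    (hi : i ∈ D) :
    (∏ j ∈ D, th (x i / q / (x j / t))) * (∏ j ∈ D, th (x i / q / (t / q * x j))) /
        ((∏ j ∈ D.erase i, th (x i / q / (x j / q))) * ∏ j ∈ D, th (x i / q / x j)) =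
      -(th t * th (q / t) / th q) * ∏ j ∈ D.erase i, thetaQuotient th q t (x j / x i) := by
  have e₁ (y : G) : x i / q / (y / t) = (q / t * (y / x i))⁻¹ := by
    rw [mul_inv, inv_div, inv_div, div_div_div_eq, div_mul_div_comm, mul_comm (x i)]
  have e₂ (y : G) : x i / q / (t / q * y) = (t * (y / x i))⁻¹ := by
    rw [mul_inv, inv_div, div_mul_eq_mul_div, div_div_div_cancel_right, ← div_div,
      div_eq_mul_inv _ t, mul_div_right_comm, mul_comm]
  have e₃ (y : G) : x i / q / (y / q) = (y / x i)⁻¹ := by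
    rw [inv_div, div_div_div_cancel_right]
  have e₄ (y : G) : x i / q / y = (q * (y / x i))⁻¹ := by
    rw [mul_inv, inv_div, div_right_comm, div_eq_mul_inv, mul_comm]
  simp only [e₁, e₂, e₃, e₄]
  rw [prod_mul_prod_div_prod_erase_mul_prod hi, div_self', mul_one, mul_one, mul_one,
    h.inv_mul_inv_div_inv hq]
  simp only [h.thetaQuotient_inv]

/- For `t ≠ 1, q` this is the vanishing of the sum of the residues at the points `x i` and
`x i / q` of an elliptic function with zeros at `x j / t` and `t x j / q`. -/
theorem sum_prod_thetaQuotient [DecidableEq ι] (q t : G) {x : ι → G} {D : Finset ι}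
    (hx : Set.InjOn x D) (hqx : ∀ i ∈ D, ∀ j ∈ D, q * x i ≠ x j) :
    ∑ i ∈ D, ∏ j ∈ D.erase i, thetaQuotient th q t (x i / x j) =
      ∑ i ∈ D, ∏ j ∈ D.erase i, thetaQuotient th q t (x j / x i) := by
  rcases D.eq_empty_or_nonempty with rfl | hD
  · simp only [Finset.sum_empty]
  have hq : q ≠ 1 := fun hq => hqx _ hD.choose_spec _ hD.choose_spec (by rw [hq, one_mul])
  by_cases ht : t = 1 ∨ t = q
  · have hone : ∀ i ∈ D, ∀ j ∈ D, i ≠ j → thetaQuotient th q t (x i / x j) = 1 :=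
      fun i hi j hj hij => thetaQuotient_eq_one ht (h.div_ne_zero fun h0 => hij (hx hi hj h0))
        (by rw [← mul_div_assoc]; exact h.div_ne_zero (hqx i hi j hj))
    refine Finset.sum_congr rfl fun i hi => Finset.prod_congr rfl fun j hj => ?_
    obtain ⟨hji, hjD⟩ := Finset.mem_erase.1 hj
    rw [hone i hi j hjD hji.symm, hone j hjD i hi hji]
  obtain ⟨ht1, htq⟩ := not_or.1 ht
  have hc : th t * th (q / t) / th q ≠ 0 :=
    _root_.div_ne_zero (mul_ne_zero (h.ne_zero ht1) (h.div_ne_zero (Ne.symm htq))) (h.ne_zero hq)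
  have hres := h.sum_div_prod_erase_eq_zero (Sum.elim x fun i => x i / q) (D.disjSum D)
    (injOn_sumElim_div hx hqx) ((D.val.map fun j => x j / t) + D.val.map fun j => t / q * x j)
    (by simp) (by have := hD.card_pos; rw [Finset.card_disjSum]; omega) (by
      rw [Multiset.prod_add, Finset.prod_disjSum]
      change (∏ j ∈ D, x j / t) * (∏ j ∈ D, t / q * x j) = (∏ j ∈ D, x j) * ∏ j ∈ D, x j / q
      rw [← Finset.prod_mul_distrib, ← Finset.prod_mul_distrib]
      refine Finset.prod_congr rfl fun j _ => ?_
      rw [← mul_assoc, ← mul_div_assoc, div_mul_cancel, mul_comm])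
  have hB : ∀ y : G, (((D.val.map fun j => x j / t) + D.val.map fun j => t / q * x j).map
      fun b => th (y / b)).prod = (∏ j ∈ D, th (y / (x j / t))) * ∏ j ∈ D, th (y / (t / q * x j)) :=
    fun y => by
      rw [Multiset.map_add, Multiset.prod_add, Multiset.map_map, Multiset.map_map]
      rfl
  simp only [hB, Finset.sum_disjSum, prod_disjSum_erase_inl, prod_disjSum_erase_inr,
    Sum.elim_inl, Sum.elim_inr] at hres
  rw [Finset.sum_congr rfl fun i hi => residue_inl th q t x hi,
    Finset.sum_congr rfl fun i hi => h.residue_inr hq t x hi, ← Finset.mul_sum, ← Finset.mul_sum,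
    neg_mul, ← sub_eq_add_neg, ← mul_sub] at hres
  exact sub_eq_zero.1 ((mul_eq_zero.1 hres).resolve_left hc)

end IsTheta

end PartialFraction

section JacobiIsTheta

open PowerSeries

variable (F : Type*) [Field F] [TopologicalSpace F] [DiscreteTopology F]

/-- The Jacobi theta series over a field, with values in the field of fractions. -/
noncomputable def jacobiFrac (u : Fˣ) : FractionRing F⟦X⟧ := algebraMap F⟦X⟧ _ (jacobi u)

/-- The units of a field as units of the field of fractions of its power series ring. -/
noncomputable def constFrac : Fˣ →* (FractionRing F⟦X⟧)ˣ :=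
  Units.map ((algebraMap F⟦X⟧ (FractionRing F⟦X⟧)).comp C : F →* _)

theorem isTheta_jacobiFrac : IsTheta (constFrac F) (jacobiFrac F) where
  eq_zero_iff u := by
    rw [jacobiFrac, map_eq_zero_iff _ (IsFractionRing.injective _ _), jacobi_eq_zero_iff]
  map_inv u := by
    rw [jacobiFrac, jacobi_inv, map_mul, map_neg]
    rfl
  exists_span B := by
    refine ⟨fun a => algebraMap F⟦X⟧ _ (laurentSum (fun k => 2 * tri k) (a * a / B)),
      fun a => algebraMap F⟦X⟧ _ (C (a : F) * laurentSum (fun k => k.natAbs ^ 2) (a * a / B)),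
      fun b₁ b₂ hB => ⟨algebraMap F⟦X⟧ _ (laurentSum (fun c => c.natAbs ^ 2) (b₂ / b₁)),
      -algebraMap F⟦X⟧ _ (C ((b₁⁻¹ : Fˣ) : F) * laurentSum (fun c => 2 * tri (c + 1)) (b₂ / b₁)),
      fun a => ?_⟩⟩
    rw [jacobiFrac, jacobiFrac, ← map_mul, jacobi_mul_jacobi, div_mul_div_comm, hB,
      div_div_div_cancel_left, div_eq_mul_inv a b₁, Units.val_mul]
    simp only [map_mul, map_sub]
    ring

end JacobiIsTheta

/-! ### Expansion in the nome -/

section ExpandAt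

open MvPowerSeries

variable {σ R : Type*} [DecidableEq σ] [CommRing R]

theorem coeff_weightedHomogeneousComponent_single (z : σ) (k : ℕ) (f : MvPowerSeries σ R)
    (d : σ →₀ ℕ) : coeff d (weightedHomogeneousComponent (Pi.single z 1) k f) =
      if d z = k then coeff d f else 0 := by
  rw [coeff_weightedHomogeneousComponent, Finsupp.weight_single_one_apply]

theorem weightedHomogeneousComponent_single_mul (z : σ) (k : ℕ) (f g : MvPowerSeries σ R) :
    weightedHomogeneousComponent (Pi.single z 1) k (f * g) =
      ∑ ij ∈ Finset.HasAntidiagonal.antidiagonal k,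
        weightedHomogeneousComponent (Pi.single z 1) ij.1 f *
          weightedHomogeneousComponent (Pi.single z 1) ij.2 g := by
  ext d
  have hterm : ∀ (ij : ℕ × ℕ) (ab : (σ →₀ ℕ) × (σ →₀ ℕ)),
      (if ab.1 z = ij.1 then coeff ab.1 f else 0) * (if ab.2 z = ij.2 then coeff ab.2 g else 0) =
        if (ab.1 z, ab.2 z) = ij then coeff ab.1 f * coeff ab.2 g else 0 := fun ij ab => by
    simp only [Prod.ext_iff, ite_and, ite_mul, mul_ite, mul_zero, zero_mul]
    split_ifs <;> rfl
  simp only [map_sum, coeff_mul, coeff_weightedHomogeneousComponent_single, hterm]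
  have hinner : ∀ ab ∈ Finset.HasAntidiagonal.antidiagonal d,
      ∑ ij ∈ Finset.HasAntidiagonal.antidiagonal k,
        (if (ab.1 z, ab.2 z) = ij then coeff ab.1 f * coeff ab.2 g else 0) =
          if d z = k then coeff ab.1 f * coeff ab.2 g else 0 := fun ab hab => by
    have hz : d z = ab.1 z + ab.2 z := by
      rw [← Finset.HasAntidiagonal.mem_antidiagonal.1 hab, Finsupp.add_apply]
    simp only [Finset.sum_ite_eq, Finset.HasAntidiagonal.mem_antidiagonal, hz]
  rw [Finset.sum_comm, Finset.sum_congr rfl hinner]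
  split_ifs
  · rfl
  · rw [Finset.sum_const_zero]

/-- The expansion of a multivariate power series in powers of the variable `z`; the coefficients
keep the power of `z`, so that `X z` is mapped to `C (X z) * X`. -/
noncomputable def expandAt (z : σ) : MvPowerSeries σ R →+* PowerSeries (MvPowerSeries σ R) where
  toFun f := PowerSeries.mk fun k => weightedHomogeneousComponent (Pi.single z 1) k f
  map_one' := by
    ext k d
    rw [PowerSeries.coeff_mk, coeff_weightedHomogeneousComponent_single, PowerSeries.coeff_one,
      coeff_one]
    by_cases hd : d = 0
    · by_cases hk : k = 0 <;> simp [hd, hk, eq_comm]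
    · by_cases hk : k = 0 <;> simp [hd, hk, coeff_one]
  map_mul' f g := by
    ext1 k
    simp only [PowerSeries.coeff_mk, PowerSeries.coeff_mul,
      weightedHomogeneousComponent_single_mul]
  map_zero' := by
    ext1 k
    rw [PowerSeries.coeff_mk, map_zero, map_zero]
  map_add' f g := by
    ext1 k
    simp only [PowerSeries.coeff_mk, map_add]

theorem coeff_coeff_expandAt (z : σ) (f : MvPowerSeries σ R) (k : ℕ) (d : σ →₀ ℕ) :
    coeff d (PowerSeries.coeff k (expandAt z f)) = if d z = k then coeff d f else 0 := by
  rw [← coeff_weightedHomogeneousComponent_single]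
  exact congrArg (coeff d)
    (PowerSeries.coeff_mk k fun k => weightedHomogeneousComponent (Pi.single z 1) k f)

theorem expandAt_injective (z : σ) :
    Function.Injective (expandAt z : MvPowerSeries σ R → PowerSeries (MvPowerSeries σ R)) :=
  fun f g h => by
    ext d
    simpa only [coeff_coeff_expandAt, if_true] using
      congrArg (fun F => coeff d (PowerSeries.coeff (d z) F)) h

theorem expandAt_X_self (z : σ) :
    expandAt z (X z : MvPowerSeries σ R) = PowerSeries.C (X z) * PowerSeries.X := by
  ext k d
  rw [coeff_coeff_expandAt, PowerSeries.coeff_C_mul, PowerSeries.coeff_X, coeff_X]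
  by_cases hd : d = Finsupp.single z 1
  · subst hd
    by_cases hk : k = 1
    · simp [hk]
    · simp [hk, Ne.symm hk]
  · by_cases hk : k = 1 <;> simp [hd, hk, coeff_X]

theorem expandAt_eq_C {z : σ} {f : MvPowerSeries σ R} (hf : ∀ d, d z ≠ 0 → coeff d f = 0) :
    expandAt z f = PowerSeries.C f := by
  ext k d
  rw [coeff_coeff_expandAt, PowerSeries.coeff_C]
  by_cases hk : k = 0
  · by_cases hd : d z = 0
    · rw [if_pos (hd.trans hk.symm), if_pos hk]
    · rw [if_neg (hk ▸ hd), if_pos hk, hf d hd]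
  · by_cases hd : d z = k
    · rw [if_pos hd, if_neg hk, hf d (hd ▸ hk), map_zero]
    · rw [if_neg hd, if_neg hk, map_zero]

theorem expandAt_X_of_ne {z k : σ} (hk : k ≠ z) :
    expandAt z (X k : MvPowerSeries σ R) = PowerSeries.C (X k) := by
  refine expandAt_eq_C fun d hd => ?_
  rw [coeff_X, if_neg]
  rintro rfl
  exact hd (Finsupp.single_eq_of_ne hk.symm)

theorem expandAt_C (z : σ) (c : R) :
    expandAt z (C c : MvPowerSeries σ R) = PowerSeries.C (C c) := by
  refine expandAt_eq_C fun d hd => ?_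
  rw [coeff_C, if_neg]
  rintro rfl
  exact hd rfl

end ExpandAt

section Slice

open MvPowerSeries

variable {n : ℕ}

theorem ratio_mul_ratio {i j k : Fin n} (hij : i ≤ j) (hjk : j ≤ k) :
    ratio i j * ratio j k = ratio i k := by
  rw [ratio, ratio, ratio, ← Finset.prod_union (Finset.Ioc_disjoint_Ioc_of_le le_rfl),
    Finset.Ioc_union_Ioc_eq_Ioc hij hjk]

/-- The field of fractions of the ring of formal power series in the variables `z_k`. -/
abbrev Frac (n : ℕ) : Type := FractionRing (MvPowerSeries (Fin n) ℂ)

/-- The embedding of the ring of formal power series into its field of fractions. -/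
noncomputable abbrev toFrac : MvPowerSeries (Fin n) ℂ →+* Frac n := algebraMap _ _

instance : IsDomain (MvPowerSeries (Fin n) ℂ) := NoZeroDivisors.to_isDomain _

instance : TopologicalSpace (Frac n) := ⊥

instance : DiscreteTopology (Frac n) := ⟨rfl⟩

theorem toFrac_ne_zero {f : MvPowerSeries (Fin n) ℂ} (hf : f ≠ 0) : toFrac f ≠ 0 :=
  (map_ne_zero_iff _ (IsFractionRing.injective _ _)).2 hf

theorem X_ne_zero (k : Fin n) : (X k : MvPowerSeries (Fin n) ℂ) ≠ 0 := fun h => by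
  simpa using congrArg (coeff (Finsupp.single k 1)) h

theorem ratio_ne_zero (i j : Fin n) : ratio i j ≠ 0 :=
  Finset.prod_ne_zero_iff.2 fun k _ => X_ne_zero k

theorem nome_ne_zero : nome n ≠ 0 :=
  Finset.prod_ne_zero_iff.2 fun k _ => X_ne_zero k

variable [NeZero n]

theorem X_zero_mul_prod_erase : X 0 * ∏ k ∈ Finset.univ.erase 0, X k = nome n :=
  Finset.mul_prod_erase Finset.univ X (Finset.mem_univ 0)

theorem rescale_C {A : Type*} [CommSemiring A] (a b : A) :
    PowerSeries.rescale a (PowerSeries.C b) = PowerSeries.C b := by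
  ext k
  rw [PowerSeries.coeff_rescale, PowerSeries.coeff_C]
  split_ifs with hk
  · rw [hk, pow_zero, one_mul]
  · rw [mul_zero]

/-- The expansion of a power series in powers of the nome, the ratios `x_j / x_i` being
treated as constants. -/
noncomputable def slice : MvPowerSeries (Fin n) ℂ →+* PowerSeries (Frac n) :=
  (PowerSeries.rescale (toFrac (nome n))⁻¹).comp ((PowerSeries.map toFrac).comp (expandAt 0))

theorem slice_injective : Function.Injective (slice (n := n)) :=
  (PowerSeries.rescale_injective (inv_ne_zero (toFrac_ne_zero nome_ne_zero))).comp
    ((PowerSeries.map_injective toFrac (IsFractionRing.injective _ _)).comp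
      (expandAt_injective (0 : Fin n)))

theorem slice_eq_C {f : MvPowerSeries (Fin n) ℂ} (hf : expandAt 0 f = PowerSeries.C f) :
    slice f = PowerSeries.C (toFrac f) := by
  rw [slice, RingHom.comp_apply, RingHom.comp_apply, hf, PowerSeries.map_C, rescale_C]

theorem slice_C (c : ℂ) :
    slice (C c : MvPowerSeries (Fin n) ℂ) = PowerSeries.C (toFrac (C c)) :=
  slice_eq_C (expandAt_C 0 c)

theorem slice_ratio (i j : Fin n) : slice (ratio i j) = PowerSeries.C (toFrac (ratio i j)) := by
  refine slice_eq_C ?_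
  rw [ratio, map_prod, map_prod]
  exact Finset.prod_congr rfl fun k hk =>
    expandAt_X_of_ne ((Fin.zero_le i).trans_lt (Finset.mem_Ioc.1 hk).1).ne'

theorem slice_nome : slice (nome n) = PowerSeries.X := by
  have hexpand : expandAt 0 (nome n) = PowerSeries.C (nome n) * PowerSeries.X := by
    rw [← X_zero_mul_prod_erase, map_mul, map_mul, map_prod, map_prod, expandAt_X_self,
      mul_right_comm,
      Finset.prod_congr rfl fun k hk => expandAt_X_of_ne (Finset.ne_of_mem_erase hk)]
  rw [slice, RingHom.comp_apply, RingHom.comp_apply, hexpand, map_mul, map_mul, PowerSeries.map_C,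
    PowerSeries.map_X, PowerSeries.rescale_X, rescale_C, ← mul_assoc, ← map_mul,
    mul_inv_cancel₀ (toFrac_ne_zero nome_ne_zero), map_one, one_mul]

theorem slice_nomeRatio (i j : Fin n) :
    slice (nomeRatio i j) = PowerSeries.X * PowerSeries.C (toFrac (ratio i j))⁻¹ := by
  have h := congrArg slice (ratio_mul_nomeRatio i j)
  rw [map_mul, slice_ratio, slice_nome] at h
  rw [← h, mul_right_comm, ← map_mul, mul_inv_cancel₀ (toFrac_ne_zero (ratio_ne_zero i j)),
    map_one, one_mul]

end Slice

section ThetaSlice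

open MvPowerSeries

variable {n : ℕ} [NeZero n]

open scoped MvPowerSeries.WithPiTopology in
theorem X_zero_pow_dvd_pochhammerInf_sub_prod (a : MvPowerSeries (Fin n) ℂ) (N : ℕ) :
    X 0 ^ N ∣ pochhammerInf a - ∏ k ∈ Finset.range N, (1 - nome n ^ k * a) := by
  refine dvd_sub_prod_of_hasProd (isClosed_setOf_X_pow_dvd 0 N)
    (multipliable_pochhammerInf a).hasProd _ fun k hk => ?_
  have hX : (X 0 : MvPowerSeries (Fin n) ℂ) ∣ nome n := ⟨_, X_zero_mul_prod_erase.symm⟩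
  rw [sub_sub_cancel_left, dvd_neg]
  exact ((pow_dvd_pow _ (by simpa using hk)).trans (pow_dvd_pow_of_dvd hX k)).mul_right a

theorem slice_pochhammerInf (a : MvPowerSeries (Fin n) ℂ) :
    slice (pochhammerInf a) = shiftedFactorial (slice a) := by
  have hX : (PowerSeries.X : PowerSeries (Frac n)) ∣ slice (X 0) := by
    rw [slice, RingHom.comp_apply, RingHom.comp_apply, expandAt_X_self, map_mul, map_mul,
      PowerSeries.map_X, PowerSeries.rescale_X]
    exact ((dvd_refl _).mul_left _).mul_left _
  refine eq_of_forall_X_pow_dvd_sub fun N => ?_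
  have hslice := (pow_dvd_pow_of_dvd hX N).trans
    (map_pow slice (X (0 : Fin n)) N ▸ map_dvd slice (X_zero_pow_dvd_pochhammerInf_sub_prod a N))
  simp only [map_sub, map_prod, map_mul, map_pow, map_one, slice_nome] at hslice
  have hshifted := X_pow_dvd_shiftedFactorial_sub_prod (a := slice a) (d := 0)
    (by rw [pow_zero]; exact one_dvd _) N
  simpa only [sub_sub_sub_cancel_right, add_zero] using dvd_sub hslice hshifted

/-- The nonzero constants as units of the field of fractions. -/
noncomputable def constUnit : ℂˣ →* (Frac n)ˣ :=
  Units.map ((toFrac.comp C : ℂ →+* Frac n) : ℂ →* Frac n)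

/-- The position variable `x_i`, normalized by `x_0 = 1`. -/
noncomputable def position (i : Fin n) : (Frac n)ˣ :=
  Units.mk0 (toFrac (ratio 0 i)) (toFrac_ne_zero (ratio_ne_zero 0 i))

theorem val_constUnit_mul_position_div {i j : Fin n} (hij : i ≤ j) (c : ℂˣ) :
    ((constUnit c * (position j / position i) : (Frac n)ˣ) : Frac n) =
      toFrac (C (c : ℂ) * ratio i j) := by
  have h : position j / position i =
      Units.mk0 (toFrac (ratio i j)) (toFrac_ne_zero (ratio_ne_zero i j)) := by
    rw [div_eq_iff_eq_mul]
    ext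
    rw [Units.val_mul, Units.val_mk0, position, position, Units.val_mk0, Units.val_mk0, ← map_mul,
      mul_comm, ratio_mul_ratio (Fin.zero_le i) hij]
  rw [h, Units.val_mul, map_mul]
  rfl

theorem shiftedFactorial_X_mul_slice_theta {i j : Fin n} (hij : i ≤ j) (c : ℂˣ) :
    shiftedFactorial PowerSeries.X * slice (theta (c : ℂ) i j) =
      jacobi (constUnit c * (position j / position i)) := by
  have hval := val_constUnit_mul_position_div hij c
  have hC : toFrac (C (c : ℂ)⁻¹) = (toFrac (C (c : ℂ)) : Frac n)⁻¹ :=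
    map_inv₀ (toFrac.comp C : ℂ →+* Frac n) (c : ℂ)
  have hdirect : slice (C (c : ℂ) * ratio i j) =
      PowerSeries.C (toFrac (C (c : ℂ) * ratio i j)) := by
    rw [map_mul, map_mul, map_mul, slice_C, slice_ratio]
  have hinverse : slice (C (c : ℂ)⁻¹ * nomeRatio i j) =
      PowerSeries.X * PowerSeries.C (toFrac (C (c : ℂ) * ratio i j))⁻¹ := by
    rw [map_mul, slice_C, slice_nomeRatio, hC, mul_left_comm, ← map_mul, ← mul_inv, ← map_mul]
  rw [← jacobi_triple_product, Units.val_inv_eq_inv_val, hval, theta, map_mul slice,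
    slice_pochhammerInf, slice_pochhammerInf, hdirect, hinverse]

end ThetaSlice

/-! ### The coefficients `𝓑_I` under `q`-shifts -/

theorem prod_Ioc_div_sub_one {n : ℕ} [NeZero n] {G : Type*} [CommGroupWithZero G] {f : Fin n → G}
    (hf : ∀ k, f k ≠ 0) {i j : Fin n} (hij : i ≤ j) :
    ∏ k ∈ Finset.Ioc i j, f k / f (k - 1) = f j / f i := by
  obtain ⟨m, rfl⟩ := Nat.exists_eq_succ_of_ne_zero (NeZero.ne n)
  induction j using Fin.induction with
  | zero => rw [Fin.le_zero_iff.1 hij, Finset.Ioc_self, Finset.prod_empty, div_self (hf 0)]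
  | succ j ih =>
    rcases hij.eq_or_lt with rfl | hlt
    · rw [Finset.Ioc_self, Finset.prod_empty, div_self (hf _)]
    · have hle : i ≤ j.castSucc := Fin.le_castSucc_iff.2 hlt
      have hIoc : Finset.Ioc i j.succ = insert j.succ (Finset.Ioc i j.castSucc) := by
        ext k
        simp only [Finset.mem_Ioc, Finset.mem_insert, Fin.lt_def, Fin.le_def, Fin.ext_iff,
          Fin.val_succ, Fin.val_castSucc] at hlt ⊢
        omega
      have hpred : j.succ - 1 = j.castSucc := by
        rw [sub_eq_iff_eq_add, Fin.coeSucc_eq_succ]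
      rw [hIoc, Finset.prod_insert (by simp [Fin.lt_def]), ih hle, hpred,
        div_mul_div_cancel₀ (hf _)]

section Shift

open MvPowerSeries

variable {n : ℕ} {q : ℂ}

/-- The factor by which the `q`-shift of the variables in `I` multiplies `x_i`. -/
noncomputable def posFactor (q : ℂ) (I : Finset (Fin n)) (i : Fin n) : ℂ := if i ∈ I then q else 1

theorem posFactor_of_mem (q : ℂ) {I : Finset (Fin n)} {i : Fin n} (hi : i ∈ I) :
    posFactor q I i = q := if_pos hi

theorem posFactor_of_notMem (q : ℂ) {I : Finset (Fin n)} {i : Fin n} (hi : i ∉ I) :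
    posFactor q I i = 1 := if_neg hi

theorem posFactor_ne_zero (hq : q ≠ 0) (I : Finset (Fin n)) (i : Fin n) :
    posFactor q I i ≠ 0 := by
  rw [posFactor]
  split_ifs
  exacts [hq, one_ne_zero]

variable [NeZero n]

/-- The `q`-shift of the variables `x_i`, `i ∈ I`, as a ring homomorphism: it multiplies
`z_k = x_k / x_{k-1}` by the quotient of the factors of `x_k` and `x_{k-1}`. -/
noncomputable def shiftHom (q : ℂ) (I : Finset (Fin n)) :
    MvPowerSeries (Fin n) ℂ →+* MvPowerSeries (Fin n) ℂ :=
  rescale fun k => posFactor q I k / posFactor q I (k - 1)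

/-- The factor by which the `q`-shift of the variables in `I` multiplies the monomial `z ^ d`. -/
noncomputable def shiftFactor (q : ℂ) (I : Finset (Fin n)) (d : Fin n →₀ ℕ) : ℂ :=
  ∏ i ∈ I, q ^ xExponent d i

theorem coeff_qShift (q : ℂ) (I : Finset (Fin n)) (f : MvPowerSeries (Fin n) ℂ) (d : Fin n →₀ ℕ) :
    coeff d (qShift q I f) = shiftFactor q I d * coeff d f := rfl

theorem shiftFactor_eq_prod_posFactor_zpow (q : ℂ) (I : Finset (Fin n)) (d : Fin n →₀ ℕ) :
    shiftFactor q I d = ∏ i, posFactor q I i ^ xExponent d i := by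
  rw [shiftFactor, ← Finset.prod_subset (Finset.subset_univ I)]
  · exact Finset.prod_congr rfl fun i hi => by rw [posFactor_of_mem q hi]
  · exact fun i _ hi => by rw [posFactor_of_notMem q hi, one_zpow]

theorem shiftHom_apply (hq : q ≠ 0) (I : Finset (Fin n)) (f : MvPowerSeries (Fin n) ℂ) :
    shiftHom q I f = qShift q I f := by
  ext d
  rw [shiftHom, coeff_rescale, coeff_qShift, shiftFactor_eq_prod_posFactor_zpow,
    Finsupp.prod_fintype _ _ fun _ => pow_zero _]
  simp only [div_pow, xExponent, zpow_sub₀ (posFactor_ne_zero hq I _), zpow_natCast,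
    Finset.prod_div_distrib]
  rw [← (Equiv.subRight (1 : Fin n)).prod_comp fun i => posFactor q I i ^ d (i + 1)]
  simp only [Equiv.subRight_apply, sub_add_cancel]

theorem shiftHom_C (q : ℂ) (I : Finset (Fin n)) (c : ℂ) : shiftHom q I (C c) = C c := by
  ext d
  rw [shiftHom, coeff_rescale, coeff_C]
  split_ifs with hd
  · rw [hd, Finsupp.prod_zero_index, one_mul]
  · rw [mul_zero]

theorem shiftHom_X (q : ℂ) (I : Finset (Fin n)) (k : Fin n) :
    shiftHom q I (X k) = C (posFactor q I k / posFactor q I (k - 1)) * X k := by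
  ext d
  rw [shiftHom, coeff_rescale, coeff_C_mul, coeff_X]
  split_ifs with hd
  · rw [hd, Finsupp.prod_single_index (h := fun s m => _ ^ m) (pow_zero _), pow_one]
  · rw [mul_zero, mul_zero]

theorem shiftHom_nome (hq : q ≠ 0) (I : Finset (Fin n)) : shiftHom q I (nome n) = nome n := by
  have hprod : ∏ k, posFactor q I k / posFactor q I (k - 1) = 1 := by
    have hshift := (Equiv.subRight (1 : Fin n)).prod_comp (posFactor q I)
    simp only [Equiv.subRight_apply] at hshift
    rw [Finset.prod_div_distrib, hshift,
      div_self (Finset.prod_ne_zero_iff.2 fun k _ => posFactor_ne_zero hq I k)]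
  simp only [nome, map_prod, shiftHom_X, Finset.prod_mul_distrib]
  rw [← map_prod, hprod, map_one, one_mul]

theorem shiftHom_ratio (hq : q ≠ 0) (I : Finset (Fin n)) {i j : Fin n} (hij : i ≤ j) :
    shiftHom q I (ratio i j) = C (posFactor q I j / posFactor q I i) * ratio i j := by
  simp only [ratio, map_prod, shiftHom_X, Finset.prod_mul_distrib]
  rw [← map_prod, prod_Ioc_div_sub_one (posFactor_ne_zero hq I) hij]

theorem shiftHom_nomeRatio (hq : q ≠ 0) (I : Finset (Fin n)) {i j : Fin n} (hij : i ≤ j) :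
    shiftHom q I (nomeRatio i j) =
      C (posFactor q I j / posFactor q I i)⁻¹ * nomeRatio i j := by
  set c := posFactor q I j / posFactor q I i with hc
  have hc0 : c ≠ 0 := div_ne_zero (posFactor_ne_zero hq I j) (posFactor_ne_zero hq I i)
  have h := congrArg (shiftHom q I) (ratio_mul_nomeRatio i j)
  rw [map_mul, shiftHom_nome hq, shiftHom_ratio hq I hij, ← hc, ← ratio_mul_nomeRatio i j,
    mul_comm (C c), mul_assoc] at h
  conv_rhs => rw [← mul_left_cancel₀ (ratio_ne_zero i j) h, ← mul_assoc, ← map_mul,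
    inv_mul_cancel₀ hc0, map_one, one_mul]

open scoped MvPowerSeries.WithPiTopology in
theorem shiftHom_pochhammerInf (hq : q ≠ 0) (I : Finset (Fin n)) (a : MvPowerSeries (Fin n) ℂ) :
    shiftHom q I (pochhammerInf a) = pochhammerInf (shiftHom q I a) := by
  have hcont : Continuous (shiftHom q I) := by
    rw [funext (shiftHom_apply hq I)]
    exact continuous_pi fun d => continuous_const.mul (WithPiTopology.continuous_coeff ℂ d)
  rw [pochhammerInf, (multipliable_pochhammerInf a).map_tprod (shiftHom q I) hcont, pochhammerInf]
  simp only [map_sub, map_one, map_mul, map_pow, shiftHom_nome hq]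

theorem shiftHom_theta (hq : q ≠ 0) (I : Finset (Fin n)) {i j : Fin n} (hij : i ≤ j) (c : ℂ) :
    shiftHom q I (theta c i j) = theta (c * (posFactor q I j / posFactor q I i)) i j := by
  rw [theta, map_mul, shiftHom_pochhammerInf hq, shiftHom_pochhammerInf hq, map_mul, map_mul,
    shiftHom_C, shiftHom_C, shiftHom_ratio hq I hij, shiftHom_nomeRatio hq I hij, theta, mul_inv,
    map_mul C, map_mul C, mul_assoc, mul_assoc]

theorem shiftHom_inv (q : ℂ) (I : Finset (Fin n)) {f : MvPowerSeries (Fin n) ℂ}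
    (hf : constantCoeff f ≠ 0) : shiftHom q I f⁻¹ = (shiftHom q I f)⁻¹ := by
  have hshift : constantCoeff (shiftHom q I f) ≠ 0 := by
    rwa [shiftHom, ← coeff_zero_eq_constantCoeff_apply, coeff_rescale, Finsupp.prod_zero_index,
      one_mul, coeff_zero_eq_constantCoeff_apply]
  rw [MvPowerSeries.eq_inv_iff_mul_eq_one hshift, ← map_mul, MvPowerSeries.inv_mul_cancel f hf,
    map_one]

end Shift

section ConstantCoeff

open MvPowerSeries

variable {n : ℕ}

theorem constantCoeff_ratio {i j : Fin n} (hij : i < j) : constantCoeff (ratio i j) = 0 := by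
  rw [ratio, map_prod]
  exact Finset.prod_eq_zero (Finset.mem_Ioc.2 ⟨hij, le_rfl⟩) (constantCoeff_X j)

variable [NeZero n]

theorem constantCoeff_nomeRatio (i j : Fin n) : constantCoeff (nomeRatio i j) = 0 := by
  rw [nomeRatio, map_prod]
  exact Finset.prod_eq_zero (i := 0) (by simp) (constantCoeff_X 0)

theorem constantCoeff_pochhammerInf (a : MvPowerSeries (Fin n) ℂ) :
    constantCoeff (pochhammerInf a) = 1 - constantCoeff a := by
  have h := map_dvd constantCoeff (X_zero_pow_dvd_pochhammerInf_sub_prod a 1)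
  rw [pow_one, constantCoeff_X, zero_dvd_iff, Finset.prod_range_one, pow_zero, one_mul, map_sub,
    map_sub, map_one] at h
  exact sub_eq_zero.1 h

theorem constantCoeff_theta {i j : Fin n} (hij : i < j) (c : ℂ) :
    constantCoeff (theta c i j) = 1 := by
  rw [theta, map_mul, constantCoeff_pochhammerInf, constantCoeff_pochhammerInf, map_mul, map_mul,
    constantCoeff_nomeRatio, constantCoeff_ratio hij, mul_zero, mul_zero, sub_zero, one_mul]

end ConstantCoeff

section Phi

open MvPowerSeries

variable {n : ℕ}

/-- The factor `θ (t c x_i / x_j; p) / θ (c x_i / x_j; p)` of the coefficients; for `i < j` the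
quasi-inversion `θ (1 / z; p) = -z⁻¹ θ (z; p)` is used to write it, up to a constant, in terms of
`x_j / x_i`. -/
noncomputable def phi (t c : ℂ) (i j : Fin n) : MvPowerSeries (Fin n) ℂ :=
  if i < j then theta (t⁻¹ * c⁻¹) i j * (theta c⁻¹ i j)⁻¹ else theta (t * c) j i * (theta c j i)⁻¹

/-- The coefficient `𝓑_I` with every `x_i` multiplied by the constant `c i`. -/
noncomputable def scaledCoeffB (t : ℂ) (c : Fin n → ℂ) (I : Finset (Fin n)) :
    MvPowerSeries (Fin n) ℂ :=
  ∏ i ∈ I, ∏ j ∈ Iᶜ, phi t (c i / c j) i j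

theorem coeffB_eq_scaledCoeffB (t : ℂ) (I : Finset (Fin n)) :
    coeffB t I = scaledCoeffB t 1 I := by
  simp only [scaledCoeffB, Pi.one_apply, div_one]
  rw [coeffB, Finset.prod_filter, Finset.prod_filter, Fintype.prod_prod_type,
    Fintype.prod_prod_type_right, ← Finset.prod_mul_distrib, ← Fintype.prod_ite_mem I]
  refine Finset.prod_congr rfl fun i _ => ?_
  rw [← Finset.prod_mul_distrib]
  by_cases hi : i ∈ I
  · rw [if_pos hi, ← Fintype.prod_ite_mem Iᶜ]
    refine Finset.prod_congr rfl fun j _ => ?_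
    rcases lt_trichotomy i j with hij | rfl | hij
    · by_cases hj : j ∈ I <;> simp [phi, hi, hj, hij, hij.not_gt]
    · simp [hi]
    · by_cases hj : j ∈ I <;> simp [phi, hi, hj, hij, hij.not_gt]
  · simp [hi]

variable [NeZero n] {q : ℂ}

theorem constantCoeff_phi (t c : ℂ) {i j : Fin n} (hij : i ≠ j) :
    constantCoeff (phi t c i j) = 1 := by
  rcases hij.lt_or_gt with h | h
  · rw [phi, if_pos h, map_mul, constantCoeff_inv, constantCoeff_theta h, constantCoeff_theta h,
      inv_one, one_mul]
  · rw [phi, if_neg h.not_gt, map_mul, constantCoeff_inv, constantCoeff_theta h,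
      constantCoeff_theta h, inv_one, one_mul]

theorem constantCoeff_coeffB (t : ℂ) (I : Finset (Fin n)) : constantCoeff (coeffB t I) = 1 := by
  rw [coeffB_eq_scaledCoeffB, scaledCoeffB, map_prod]
  refine Finset.prod_eq_one fun i hi => ?_
  rw [map_prod]
  exact Finset.prod_eq_one fun j hj => constantCoeff_phi t _
    (ne_of_mem_of_not_mem hi (Finset.mem_compl.1 hj))

theorem shiftHom_phi (hq : q ≠ 0) (I : Finset (Fin n)) (t c : ℂ) {i j : Fin n} (hij : i ≠ j) :
    shiftHom q I (phi t c i j) = phi t (c * (posFactor q I i / posFactor q I j)) i j := by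
  have hunit : ∀ {i j : Fin n}, i < j → ∀ c, constantCoeff (theta c i j) ≠ 0 := fun h c => by
    rw [constantCoeff_theta h]
    exact one_ne_zero
  rcases hij.lt_or_gt with h | h
  · rw [phi, phi, if_pos h, if_pos h, map_mul, shiftHom_inv q I (hunit h _),
      shiftHom_theta hq I h.le, shiftHom_theta hq I h.le, mul_inv c, inv_div, mul_assoc]
  · rw [phi, phi, if_neg h.not_gt, if_neg h.not_gt, map_mul, shiftHom_inv q I (hunit h _),
      shiftHom_theta hq I h.le, shiftHom_theta hq I h.le, mul_assoc]

theorem shiftHom_coeffB (hq : q ≠ 0) (t : ℂ) (I J : Finset (Fin n)) :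
    shiftHom q I (coeffB t J) = scaledCoeffB t (posFactor q I) J := by
  rw [coeffB_eq_scaledCoeffB, scaledCoeffB, scaledCoeffB, map_prod]
  refine Finset.prod_congr rfl fun i hi => ?_
  rw [map_prod]
  refine Finset.prod_congr rfl fun j hj => ?_
  rw [shiftHom_phi hq I t _ (ne_of_mem_of_not_mem hi (Finset.mem_compl.1 hj)), Pi.one_apply,
    Pi.one_apply, div_one, one_mul]

end Phi

section ScaledCoeffB

open MvPowerSeries

variable {n : ℕ} (t : ℂ) (c : Fin n → ℂ) {i : Fin n} {K : Finset (Fin n)}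

theorem scaledCoeffB_of_mem (hi : i ∈ K) :
    scaledCoeffB t c K = (∏ j ∈ Kᶜ, phi t (c i / c j) i j) *
      ∏ k ∈ K.erase i, ∏ j ∈ Kᶜ, phi t (c k / c j) k j :=
  (Finset.mul_prod_erase K _ hi).symm

theorem scaledCoeffB_singleton (hi : i ∈ K) :
    scaledCoeffB t c {i} = (∏ j ∈ K.erase i, phi t (c i / c j) i j) *
      ∏ j ∈ Kᶜ, phi t (c i / c j) i j := by
  have hcompl : ({i} : Finset (Fin n))ᶜ = K.erase i ∪ Kᶜ := by
    ext k
    by_cases hk : k = i <;> simp [hk, hi, em]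
  rw [scaledCoeffB, Finset.prod_singleton, hcompl, Finset.prod_union
    (disjoint_compl_right.mono_left (Finset.erase_subset i K))]

theorem scaledCoeffB_erase (hi : i ∈ K) :
    scaledCoeffB t c (K.erase i) = (∏ k ∈ K.erase i, phi t (c k / c i) k i) *
      ∏ k ∈ K.erase i, ∏ j ∈ Kᶜ, phi t (c k / c j) k j := by
  rw [scaledCoeffB, Finset.compl_erase, ← Finset.prod_mul_distrib]
  exact Finset.prod_congr rfl fun k _ => Finset.prod_insert fun h => Finset.mem_compl.1 h hi

end ScaledCoeffB

section CoeffBShift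

open MvPowerSeries

variable {n : ℕ} [NeZero n] {q : ℂ}

theorem coeffB_mul_shift_of_mem (hq : q ≠ 0) (t : ℂ) {i : Fin n} {J : Finset (Fin n)}
    (hi : i ∈ J) :
    coeffB t {i} * shiftHom q {i} (coeffB t J) = coeffB t J * shiftHom q J (coeffB t {i}) := by
  rw [shiftHom_coeffB hq, shiftHom_coeffB hq, coeffB_eq_scaledCoeffB, coeffB_eq_scaledCoeffB,
    scaledCoeffB_singleton t _ hi, scaledCoeffB_singleton t _ hi, scaledCoeffB_of_mem t _ hi,
    scaledCoeffB_of_mem t _ hi]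
  have hsingle : ∀ k ≠ i, posFactor q {i} k = 1 := fun k hk =>
    posFactor_of_notMem q (Finset.notMem_singleton.2 hk)
  have hinside : ∏ j ∈ J.erase i, phi t (posFactor q J i / posFactor q J j) i j =
      ∏ j ∈ J.erase i, phi t 1 i j := by
    refine Finset.prod_congr rfl fun j hj => ?_
    rw [posFactor_of_mem q hi, posFactor_of_mem q (Finset.mem_of_mem_erase hj), div_self hq]
  have houtside : ∀ k ∈ J.erase i,
      ∏ j ∈ Jᶜ, phi t (posFactor q {i} k / posFactor q {i} j) k j = ∏ j ∈ Jᶜ, phi t 1 k j := by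
    refine fun k hk => Finset.prod_congr rfl fun j hj => ?_
    rw [hsingle k (Finset.ne_of_mem_erase hk),
      hsingle j (ne_of_mem_of_not_mem hi (Finset.mem_compl.1 hj)).symm, div_one]
  have hcross : ∏ j ∈ Jᶜ, phi t (posFactor q J i / posFactor q J j) i j =
      ∏ j ∈ Jᶜ, phi t (posFactor q {i} i / posFactor q {i} j) i j := by
    refine Finset.prod_congr rfl fun j hj => ?_
    rw [hsingle j (ne_of_mem_of_not_mem hi (Finset.mem_compl.1 hj)).symm, posFactor_of_mem q hi,
      posFactor_of_notMem q (Finset.mem_compl.1 hj),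
      posFactor_of_mem q (Finset.mem_singleton_self i)]
  rw [hinside, hcross, Finset.prod_congr rfl houtside]
  simp only [Pi.one_apply, div_one]
  ring

theorem coeffB_singleton_mul_shift_erase (hq : q ≠ 0) (t : ℂ) {i : Fin n} {K : Finset (Fin n)}
    (hi : i ∈ K) :
    coeffB t {i} * shiftHom q {i} (coeffB t (K.erase i)) =
      coeffB t K * ∏ j ∈ K.erase i, phi t 1 i j * phi t q⁻¹ j i := by
  rw [shiftHom_coeffB hq, coeffB_eq_scaledCoeffB, coeffB_eq_scaledCoeffB,
    scaledCoeffB_singleton t _ hi, scaledCoeffB_erase t _ hi, scaledCoeffB_of_mem t _ hi,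
    Finset.prod_mul_distrib]
  have hsingle : ∀ k ≠ i, posFactor q {i} k = 1 := fun k hk =>
    posFactor_of_notMem q (Finset.notMem_singleton.2 hk)
  have hback : ∏ k ∈ K.erase i, phi t (posFactor q {i} k / posFactor q {i} i) k i =
      ∏ k ∈ K.erase i, phi t q⁻¹ k i := by
    refine Finset.prod_congr rfl fun k hk => ?_
    rw [hsingle k (Finset.ne_of_mem_erase hk), posFactor_of_mem q (Finset.mem_singleton_self i),
      one_div]
  have houtside : ∀ k ∈ K.erase i,
      ∏ j ∈ Kᶜ, phi t (posFactor q {i} k / posFactor q {i} j) k j = ∏ j ∈ Kᶜ, phi t 1 k j := by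
    refine fun k hk => Finset.prod_congr rfl fun j hj => ?_
    rw [hsingle k (Finset.ne_of_mem_erase hk),
      hsingle j (ne_of_mem_of_not_mem hi (Finset.mem_compl.1 hj)).symm, div_one]
  rw [hback, Finset.prod_congr rfl houtside]
  simp only [Pi.one_apply, div_one]
  ring

theorem coeffB_erase_mul_shift_singleton (hq : q ≠ 0) (t : ℂ) {i : Fin n} {K : Finset (Fin n)}
    (hi : i ∈ K) :
    coeffB t (K.erase i) * shiftHom q (K.erase i) (coeffB t {i}) =
      coeffB t K * ∏ j ∈ K.erase i, phi t 1 j i * phi t q⁻¹ i j := by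
  rw [shiftHom_coeffB hq, coeffB_eq_scaledCoeffB, coeffB_eq_scaledCoeffB,
    scaledCoeffB_singleton t _ hi, scaledCoeffB_erase t _ hi, scaledCoeffB_of_mem t _ hi,
    Finset.prod_mul_distrib]
  have hi' : posFactor q (K.erase i) i = 1 := posFactor_of_notMem q (Finset.notMem_erase i K)
  have hforward : ∏ j ∈ K.erase i, phi t (posFactor q (K.erase i) i / posFactor q (K.erase i) j) i j
      = ∏ j ∈ K.erase i, phi t q⁻¹ i j := by
    refine Finset.prod_congr rfl fun j hj => ?_
    rw [hi', posFactor_of_mem q hj, one_div]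
  have houtside : ∏ j ∈ Kᶜ, phi t (posFactor q (K.erase i) i / posFactor q (K.erase i) j) i j =
      ∏ j ∈ Kᶜ, phi t 1 i j := by
    refine Finset.prod_congr rfl fun j hj => ?_
    rw [hi', posFactor_of_notMem q fun h => Finset.mem_compl.1 hj (Finset.mem_of_mem_erase h),
      div_one]
  rw [hforward, houtside]
  simp only [Pi.one_apply, div_one]
  ring

end CoeffBShift

section ThetaIdentity

open MvPowerSeries

variable {n : ℕ} [NeZero n]

/-- The ring of formal power series inside a field on which theta functions of all ratios of
positions are defined. -/
noncomputable def embed : MvPowerSeries (Fin n) ℂ →+* FractionRing (PowerSeries (Frac n)) :=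
  (algebraMap _ _).comp slice

theorem embed_injective : Function.Injective (embed (n := n)) :=
  (IsFractionRing.injective _ _).comp slice_injective

theorem embed_inv {f : MvPowerSeries (Fin n) ℂ} (hf : constantCoeff f ≠ 0) :
    embed f⁻¹ = (embed f)⁻¹ := by
  refine eq_inv_of_mul_eq_one_left ?_
  rw [← map_mul, MvPowerSeries.inv_mul_cancel f hf, map_one]

theorem embed_theta_mul_inv {i j : Fin n} (hij : i < j) (a c : ℂˣ) :
    embed (theta (a : ℂ) i j * (theta (c : ℂ) i j)⁻¹) =
      jacobiFrac (Frac n) (constUnit a * (position j / position i)) /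
        jacobiFrac (Frac n) (constUnit c * (position j / position i)) := by
  have hconst : algebraMap (PowerSeries (Frac n)) (FractionRing (PowerSeries (Frac n)))
      (shiftedFactorial PowerSeries.X) ≠ 0 :=
    (map_ne_zero_iff _ (IsFractionRing.injective _ _)).2 isUnit_shiftedFactorial_X.ne_zero
  have hunit : constantCoeff (theta (c : ℂ) i j) ≠ 0 := by
    rw [constantCoeff_theta hij]
    exact one_ne_zero
  rw [jacobiFrac, jacobiFrac, ← shiftedFactorial_X_mul_slice_theta hij.le,
    ← shiftedFactorial_X_mul_slice_theta hij.le, map_mul (algebraMap _ _),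
    map_mul (algebraMap _ _), mul_div_mul_left _ _ hconst, map_mul, embed_inv hunit, embed,
    RingHom.comp_apply, RingHom.comp_apply, div_eq_mul_inv]

theorem embed_phi_of_lt {i j : Fin n} (hij : i < j) (t c : ℂˣ) :
    embed (phi (t : ℂ) (c : ℂ) i j) =
      jacobiFrac (Frac n) (constUnit t * (constUnit c * (position i / position j)))⁻¹ /
        jacobiFrac (Frac n) (constUnit c * (position i / position j))⁻¹ := by
  have h := embed_theta_mul_inv hij (t⁻¹ * c⁻¹) c⁻¹
  simp only [Units.val_mul, Units.val_inv_eq_inv_val, map_mul, map_inv] at h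
  rw [phi, if_pos hij, map_mul, h]
  simp only [mul_inv, inv_div, mul_assoc]

theorem embed_phi_of_gt {i j : Fin n} (hij : j < i) (t c : ℂˣ) :
    embed (phi (t : ℂ) (c : ℂ) i j) =
      jacobiFrac (Frac n) (constUnit t * (constUnit c * (position i / position j))) /
        jacobiFrac (Frac n) (constUnit c * (position i / position j)) := by
  have h := embed_theta_mul_inv hij (t * c) c
  simp only [Units.val_mul, map_mul, mul_assoc] at h
  rw [phi, if_neg hij.not_gt, map_mul, h]

theorem constUnit_mul_position_div_ne_one {i j : Fin n} (hij : i < j) (c : ℂˣ) :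
    constUnit c * (position j / position i) ≠ 1 := fun h => by
  have hval := val_constUnit_mul_position_div hij.le c
  rw [h, Units.val_one, ← map_one toFrac] at hval
  have hconst := congrArg constantCoeff (IsFractionRing.injective _ (Frac n) hval)
  rw [map_one, map_mul, constantCoeff_ratio hij, mul_zero] at hconst
  exact one_ne_zero hconst

theorem constUnit_mul_position_ne {i j : Fin n} (hij : i ≠ j) (c : ℂˣ) :
    constUnit c * position i ≠ position j := by
  intro h
  rcases hij.lt_or_gt with hlt | hgt
  · refine constUnit_mul_position_div_ne_one hlt c⁻¹ ?_
    rw [← h, mul_div_cancel_right, map_inv, inv_mul_cancel]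
  · refine constUnit_mul_position_div_ne_one hgt c ?_
    rw [← h, mul_comm _ (position i), div_mul_cancel_left, mul_inv_cancel]

theorem embed_phi_mul_phi {q t : ℂˣ} {i j : Fin n} (hij : i ≠ j) :
    embed (phi (t : ℂ) 1 i j * phi (t : ℂ) (q : ℂ)⁻¹ j i) =
      thetaQuotient (jacobiFrac (Frac n)) (constUnit q) (constUnit t)
        (position i / position j) := by
  have hflip : (position j / position i : (Frac n)ˣ) = (position i / position j)⁻¹ :=
    (inv_div _ _).symm
  have hnum : ∀ v : (Frac n)ˣ, constUnit t * ((constUnit q)⁻¹ * v⁻¹) =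
      (constUnit q / constUnit t * v)⁻¹ := fun v => by
    rw [mul_inv, inv_div, div_eq_mul_inv, mul_assoc]
  have hden : ∀ v : (Frac n)ˣ, (constUnit q)⁻¹ * v⁻¹ = (constUnit q * v)⁻¹ := fun v =>
    (mul_inv _ _).symm
  rw [map_mul, ← Units.val_one, ← Units.val_inv_eq_inv_val]
  rcases hij.lt_or_gt with h | h
  · rw [embed_phi_of_lt h, embed_phi_of_gt h, hflip, map_one, one_mul, map_inv, hnum, hden,
      ← (isTheta_jacobiFrac (Frac n)).thetaQuotient_inv, div_mul_div_comm,
      mul_comm (jacobiFrac _ _)]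
  · rw [embed_phi_of_gt h, embed_phi_of_lt h, hflip, map_one, one_mul, map_inv, hnum, hden,
      inv_inv, inv_inv, thetaQuotient, div_mul_div_comm]

theorem sum_prod_phi {q t : ℂ} (hq0 : q ≠ 0) (hq1 : q ≠ 1) (ht : t ≠ 0) (K : Finset (Fin n)) :
    ∑ i ∈ K, ∏ j ∈ K.erase i, phi t 1 i j * phi t q⁻¹ j i =
      ∑ i ∈ K, ∏ j ∈ K.erase i, phi t 1 j i * phi t q⁻¹ i j := by
  lift q to ℂˣ using hq0.isUnit
  lift t to ℂˣ using ht.isUnit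
  have hq : ∀ i j : Fin n, constUnit q * position i ≠ position j := fun i j h => by
    by_cases hij : i = j
    · subst hij
      exact hq1 <| (toFrac.comp (C : ℂ →+* MvPowerSeries (Fin n) ℂ)).injective <|
        (congrArg Units.val (mul_eq_right.1 h)).trans (map_one _).symm
    · exact constUnit_mul_position_ne hij q h
  have hposition : Set.InjOn (position (n := n)) K := fun i _ j _ h => by
    by_contra hij
    exact constUnit_mul_position_ne hij 1 (by rw [map_one, one_mul, h])
  apply embed_injective
  simp only [map_sum, map_prod]
  convert (isTheta_jacobiFrac (Frac n)).sum_prod_thetaQuotient (constUnit q) (constUnit t)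
    hposition fun i _ j _ => hq i j using 1
  · exact Finset.sum_congr rfl fun i _ => Finset.prod_congr rfl fun j hj =>
      embed_phi_mul_phi (Finset.ne_of_mem_erase hj).symm
  · exact Finset.sum_congr rfl fun i _ => Finset.prod_congr rfl fun j hj =>
      embed_phi_mul_phi (Finset.ne_of_mem_erase hj)

end ThetaIdentity

/-! ### Commutation with the first operator -/

theorem sum_powersetCard_sum_compl {ι M : Type*} [Fintype ι] [DecidableEq ι] [AddCommMonoid M]
    (r : ℕ) (g : ι → Finset ι → M) :
    ∑ J ∈ Finset.powersetCard r (Finset.univ : Finset ι), ∑ i ∈ Jᶜ, g i J =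
      ∑ K ∈ Finset.powersetCard (r + 1) (Finset.univ : Finset ι),
        ∑ i ∈ K, g i (K.erase i) := by
  simp only [Finset.sum_sigma']
  refine Finset.sum_bij' (fun x _ => ⟨insert x.2 x.1, x.2⟩) (fun x _ => ⟨x.1.erase x.2, x.2⟩)
    ?_ ?_ ?_ ?_ ?_
  · rintro ⟨J, i⟩ h
    simp only [Finset.mem_sigma, Finset.mem_powersetCard, Finset.subset_univ, true_and,
      Finset.mem_compl] at h ⊢
    exact ⟨by rw [Finset.card_insert_of_notMem h.2, h.1], Finset.mem_insert_self _ _⟩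
  · rintro ⟨K, i⟩ h
    simp only [Finset.mem_sigma, Finset.mem_powersetCard, Finset.subset_univ, true_and,
      Finset.mem_compl] at h ⊢
    exact ⟨by rw [Finset.card_erase_of_mem h.2, h.1, Nat.add_sub_cancel], Finset.notMem_erase _ _⟩
  · rintro ⟨J, i⟩ h
    simp only [Finset.mem_sigma, Finset.mem_compl] at h
    simp [Finset.erase_insert h.2]
  · rintro ⟨K, i⟩ h
    simp only [Finset.mem_sigma] at h
    simp [Finset.insert_erase h.2]
  · rintro ⟨J, i⟩ h
    simp only [Finset.mem_sigma, Finset.mem_compl] at h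
    simp [Finset.erase_insert h.2]

theorem sum_powersetCard_sum_univ {ι M : Type*} [Fintype ι] [DecidableEq ι] [AddCommMonoid M]
    (r : ℕ) (g : ι → Finset ι → M) :
    ∑ J ∈ Finset.powersetCard r (Finset.univ : Finset ι), ∑ i, g i J =
      ∑ J ∈ Finset.powersetCard r (Finset.univ : Finset ι), ∑ i ∈ J, g i J +
        ∑ K ∈ Finset.powersetCard (r + 1) (Finset.univ : Finset ι), ∑ i ∈ K, g i (K.erase i) := by
  rw [← sum_powersetCard_sum_compl, ← Finset.sum_add_distrib]
  exact Finset.sum_congr rfl fun J _ => (Finset.sum_add_sum_compl J _).symm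

section CommuteFirst

open MvPowerSeries

variable {n : ℕ} [NeZero n] {q : ℂ}

theorem qShift_comm (q : ℂ) (I J : Finset (Fin n)) (f : MvPowerSeries (Fin n) ℂ) :
    qShift q I (qShift q J f) = qShift q J (qShift q I f) := by
  ext d
  simp only [coeff_qShift, mul_left_comm]

theorem qShift_singleton_erase (q : ℂ) {i : Fin n} {K : Finset (Fin n)} (hi : i ∈ K)
    (f : MvPowerSeries (Fin n) ℂ) :
    qShift q {i} (qShift q (K.erase i) f) = qShift q K f := by
  ext d
  simp only [coeff_qShift, shiftFactor, ← mul_assoc, Finset.prod_singleton,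
    Finset.mul_prod_erase K (fun i => q ^ xExponent d i) hi]

theorem modifiedOperator_modifiedOperator (hq : q ≠ 0) (t : ℂ) (s : Fin n → ℂ) (r l : ℕ)
    (f : MvPowerSeries (Fin n) ℂ) :
    modifiedOperator q t s r (modifiedOperator q t s l f) =
      ∑ I ∈ Finset.powersetCard r Finset.univ, ∑ J ∈ Finset.powersetCard l Finset.univ,
        C ((∏ i ∈ I, s i) * ∏ j ∈ J, s j) * (coeffB t I * shiftHom q I (coeffB t J)) *
          qShift q I (qShift q J f) := by
  unfold modifiedOperator
  refine Finset.sum_congr rfl fun I _ => ?_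
  rw [← shiftHom_apply hq, map_sum, Finset.mul_sum]
  refine Finset.sum_congr rfl fun J _ => ?_
  rw [map_mul, map_mul, shiftHom_C, shiftHom_apply hq, shiftHom_apply hq, map_mul C]
  ring

theorem sum_coeffB_shift_erase_comm (hq0 : q ≠ 0) (hq1 : q ≠ 1) {t : ℂ} (ht : t ≠ 0)
    (s : Fin n → ℂ) (K : Finset (Fin n)) (f : MvPowerSeries (Fin n) ℂ) :
    ∑ i ∈ K, C (s i * ∏ j ∈ K.erase i, s j) *
        (coeffB t {i} * shiftHom q {i} (coeffB t (K.erase i))) *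
          qShift q {i} (qShift q (K.erase i) f) =
      ∑ i ∈ K, C ((∏ j ∈ K.erase i, s j) * s i) *
        (coeffB t (K.erase i) * shiftHom q (K.erase i) (coeffB t {i})) *
          qShift q (K.erase i) (qShift q {i} f) := by
  set A := C (∏ j ∈ K, s j) * coeffB t K * qShift q K f with hA
  have hleft : ∀ i ∈ K, C (s i * ∏ j ∈ K.erase i, s j) *
      (coeffB t {i} * shiftHom q {i} (coeffB t (K.erase i))) *
        qShift q {i} (qShift q (K.erase i) f) =
      A * ∏ j ∈ K.erase i, phi t 1 i j * phi t q⁻¹ j i := fun i hi => by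
    rw [coeffB_singleton_mul_shift_erase hq0 t hi, Finset.mul_prod_erase K s hi,
      qShift_singleton_erase q hi, hA]
    ring
  have hright : ∀ i ∈ K, C ((∏ j ∈ K.erase i, s j) * s i) *
      (coeffB t (K.erase i) * shiftHom q (K.erase i) (coeffB t {i})) *
        qShift q (K.erase i) (qShift q {i} f) =
      A * ∏ j ∈ K.erase i, phi t 1 j i * phi t q⁻¹ i j := fun i hi => by
    rw [coeffB_erase_mul_shift_singleton hq0 t hi, Finset.prod_erase_mul K s hi, qShift_comm,
      qShift_singleton_erase q hi, hA]
    ring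
  rw [Finset.sum_congr rfl hleft, Finset.sum_congr rfl hright, ← Finset.mul_sum,
    ← Finset.mul_sum, sum_prod_phi hq0 hq1 ht]

theorem modifiedOperator_one_comm (hq0 : q ≠ 0) (hq1 : q ≠ 1) {t : ℂ} (ht : t ≠ 0)
    (s : Fin n → ℂ) (r : ℕ) (f : MvPowerSeries (Fin n) ℂ) :
    modifiedOperator q t s 1 (modifiedOperator q t s r f) =
      modifiedOperator q t s r (modifiedOperator q t s 1 f) := by
  rw [modifiedOperator_modifiedOperator hq0, modifiedOperator_modifiedOperator hq0,
    Finset.sum_comm]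
  simp only [Finset.powersetCard_one, Finset.sum_map, Function.Embedding.coeFn_mk,
    Finset.prod_singleton]
  rw [sum_powersetCard_sum_univ r fun i J => C (s i * ∏ j ∈ J, s j) *
      (coeffB t {i} * shiftHom q {i} (coeffB t J)) * qShift q {i} (qShift q J f),
    sum_powersetCard_sum_univ r fun i J => C ((∏ j ∈ J, s j) * s i) *
      (coeffB t J * shiftHom q J (coeffB t {i})) * qShift q J (qShift q {i} f)]
  refine congrArg₂ (· + ·) (Finset.sum_congr rfl fun J _ => Finset.sum_congr rfl fun i hi => ?_)
    (Finset.sum_congr rfl fun K _ => sum_coeffB_shift_erase_comm hq0 hq1 ht s K f)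
  rw [coeffB_mul_shift_of_mem hq0 t hi, qShift_comm, mul_comm (s i)]

end CommuteFirst

/-! ### Nonresonant operators -/

section LowestCoefficient

open MvPowerSeries

variable {σ R : Type*} [CommSemiring R]

theorem coeff_mul_of_coeff_lt_left {d : σ →₀ ℕ} {f g : MvPowerSeries σ R}
    (h : ∀ e < d, coeff e f = 0) : coeff d (f * g) = coeff d f * constantCoeff g := by
  classical
  rw [coeff_mul, Finset.sum_eq_single (d, 0)]
  · rw [coeff_zero_eq_constantCoeff_apply]
  · rintro ⟨a, b⟩ hab hne
    have hab : a + b = d := Finset.HasAntidiagonal.mem_antidiagonal.1 hab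
    have hlt : a < d := lt_of_le_of_ne (hab ▸ le_self_add) fun h0 => hne <| by
      subst h0
      exact congrArg (Prod.mk a) (add_eq_left.1 hab)
    rw [h a hlt, zero_mul]
  · exact fun h0 => absurd (Finset.HasAntidiagonal.mem_antidiagonal.2 (add_zero d)) h0

theorem coeff_mul_of_coeff_lt_right {d : σ →₀ ℕ} {f g : MvPowerSeries σ R}
    (h : ∀ e < d, coeff e g = 0) : coeff d (f * g) = constantCoeff f * coeff d g := by
  rw [mul_comm, coeff_mul_of_coeff_lt_left h, mul_comm]

theorem exists_eq_self_of_causal [Finite σ] (Φ : MvPowerSeries σ R → MvPowerSeries σ R)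
    (hΦ : ∀ f g d, (∀ e < d, coeff e f = coeff e g) → coeff d (Φ f) = coeff d (Φ g)) :
    ∃ f, Φ f = f := by
  classical
  have wf : WellFounded ((· < ·) : (σ →₀ ℕ) → (σ →₀ ℕ) → Prop) := wellFounded_lt
  let step : (d : σ →₀ ℕ) → ((e : σ →₀ ℕ) → e < d → R) → R := fun d rec =>
    coeff d (Φ fun e => if h : e < d then rec e h else 0)
  let f : MvPowerSeries σ R := fun d => wf.fix step d
  refine ⟨f, MvPowerSeries.ext fun d => ?_⟩
  have hfix : coeff d f = step d fun e _ => wf.fix step e := wf.fix_eq step d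
  rw [hfix]
  refine hΦ _ _ d fun e he => ?_
  change _ = dite (e < d) _ _
  rw [dif_pos he]
  rfl

end LowestCoefficient

section NomePart

open MvPowerSeries

variable {n : ℕ}

/-- The exponent of `p ^ k` as a monomial in `z_0, …, z_{n-1}`. -/
noncomputable def diag (n k : ℕ) : Fin n →₀ ℕ := Finsupp.equivFunOnFinite.symm fun _ => k

theorem diag_apply (k : ℕ) (i : Fin n) : diag n k i = k := rfl

theorem diag_zero : diag n 0 = 0 := Finsupp.ext fun _ => rfl

theorem diag_injective [NeZero n] : Function.Injective (diag n) := fun k l h => by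
  simpa only [diag_apply] using DFunLike.congr_fun h 0

theorem mem_range_diag_of_xExponent [NeZero n] {d : Fin n →₀ ℕ} (h : ∀ i, xExponent d i = 0) :
    d ∈ Set.range (diag n) := by
  obtain ⟨m, rfl⟩ := Nat.exists_eq_succ_of_ne_zero (NeZero.ne n)
  refine ⟨d 0, Finsupp.ext fun i => ?_⟩
  rw [diag_apply]
  induction i using Fin.induction with
  | zero => rfl
  | succ i ih =>
    have hi := h i.castSucc
    rw [xExponent, Fin.coeSucc_eq_succ, sub_eq_zero, Nat.cast_inj] at hi
    exact ih.trans hi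

theorem nome_pow_eq_monomial (k : ℕ) : nome n ^ k = monomial (diag n k) (1 : ℂ) := by
  have hsum : ∑ i : Fin n, Finsupp.single i k = diag n k := by
    ext j
    simp [diag_apply, Finsupp.finsetSum_apply, Finsupp.single_apply]
  simp only [nome, ← Finset.prod_pow, X_pow_eq, prod_monomial, Finset.prod_const_one, hsum]

/-- The projection of a power series in `z_0, …, z_{n-1}` to its terms in the powers of the
nome. -/
noncomputable def nomePart : MvPowerSeries (Fin n) ℂ →ₗ[ℂ] PowerSeries ℂ where
  toFun f := PowerSeries.mk fun k => coeff (diag n k) f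
  map_add' f g := by
    ext k
    simp only [PowerSeries.coeff_mk, map_add]
  map_smul' c f := by
    ext k
    simp only [PowerSeries.coeff_mk, map_smul, RingHom.id_apply]

theorem coeff_nomePart (f : MvPowerSeries (Fin n) ℂ) (k : ℕ) :
    PowerSeries.coeff k (nomePart f) = coeff (diag n k) f :=
  PowerSeries.coeff_mk k fun k => coeff (diag n k) f

theorem constantCoeff_nomePart (f : MvPowerSeries (Fin n) ℂ) :
    PowerSeries.constantCoeff (nomePart f) = constantCoeff f := by
  rw [← PowerSeries.coeff_zero_eq_constantCoeff_apply, coeff_nomePart, diag_zero,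
    coeff_zero_eq_constantCoeff_apply]

variable [NeZero n]

theorem coeff_ofNome_diag (γ : PowerSeries ℂ) (k : ℕ) :
    coeff (diag n k) (ofNome γ) = PowerSeries.coeff k γ := by
  classical
  rw [ofNome, PowerSeries.coeff_subst (hasSubst_nome n), finsum_eq_single _ k]
  · rw [nome_pow_eq_monomial, coeff_monomial_same, smul_eq_mul, mul_one]
  · intro l hl
    rw [nome_pow_eq_monomial, coeff_monomial_ne (diag_injective.ne hl.symm), smul_zero]

theorem coeff_ofNome_of_notMem (γ : PowerSeries ℂ) {d : Fin n →₀ ℕ}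
    (hd : d ∉ Set.range (diag n)) : coeff d (ofNome γ) = 0 := by
  classical
  rw [ofNome, PowerSeries.coeff_subst (hasSubst_nome n)]
  refine finsum_eq_zero_of_forall_eq_zero fun k => ?_
  rw [nome_pow_eq_monomial, coeff_monomial_ne fun h => hd ⟨k, h.symm⟩, smul_zero]

theorem ofNome_mul (γ δ : PowerSeries ℂ) :
    (ofNome (γ * δ) : MvPowerSeries (Fin n) ℂ) = ofNome γ * ofNome δ :=
  PowerSeries.subst_mul (hasSubst_nome n) γ δ

theorem ofNome_sub (γ δ : PowerSeries ℂ) :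
    (ofNome (γ - δ) : MvPowerSeries (Fin n) ℂ) = ofNome γ - ofNome δ :=
  PowerSeries.subst_sub (hasSubst_nome n) γ δ

theorem ofNome_C (c : ℂ) : (ofNome (PowerSeries.C c) : MvPowerSeries (Fin n) ℂ) = C c := by
  rw [ofNome, ← PowerSeries.coe_substAlgHom (hasSubst_nome n)]
  exact (PowerSeries.substAlgHom (hasSubst_nome n)).commutes c

theorem ofNome_sum {ι : Type*} (A : Finset ι) (γ : ι → PowerSeries ℂ) :
    (ofNome (∑ a ∈ A, γ a) : MvPowerSeries (Fin n) ℂ) = ∑ a ∈ A, ofNome (γ a) := by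
  simp only [ofNome, ← PowerSeries.coe_substAlgHom (hasSubst_nome n), map_sum]

theorem constantCoeff_ofNome (γ : PowerSeries ℂ) :
    constantCoeff (ofNome γ : MvPowerSeries (Fin n) ℂ) = PowerSeries.constantCoeff γ := by
  rw [← coeff_zero_eq_constantCoeff_apply, ← diag_zero, coeff_ofNome_diag,
    PowerSeries.coeff_zero_eq_constantCoeff_apply]

theorem nomePart_ofNome_mul (γ : PowerSeries ℂ) (f : MvPowerSeries (Fin n) ℂ) :
    nomePart (ofNome γ * f) = γ * nomePart f := by
  classical
  ext k
  rw [coeff_nomePart, coeff_mul, PowerSeries.coeff_mul]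
  refine (Finset.sum_of_injOn (fun ab => (diag n ab.1, diag n ab.2)) ?_ ?_ ?_ ?_).symm
  · exact fun _ _ _ _ h => Prod.ext (diag_injective (congrArg Prod.fst h))
      (diag_injective (congrArg Prod.snd h))
  · intro ab hab
    have hab : ab.1 + ab.2 = k := Finset.HasAntidiagonal.mem_antidiagonal.1 hab
    refine Finset.HasAntidiagonal.mem_antidiagonal.2 (Finsupp.ext fun i => ?_)
    simpa only [Finsupp.add_apply, diag_apply] using hab
  · rintro ⟨a, b⟩ hab hne
    have hab : a + b = diag n k := Finset.HasAntidiagonal.mem_antidiagonal.1 hab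
    have ha : a ∉ Set.range (diag n) := by
      rintro ⟨l, rfl⟩
      have hb : ∀ i, l + b i = k := DFunLike.congr_fun hab
      refine hne ⟨(l, b 0), Finset.HasAntidiagonal.mem_antidiagonal.2 (hb 0), ?_⟩
      refine Prod.ext rfl (Finsupp.ext fun i => ?_)
      exact Nat.add_left_cancel ((hb 0).trans (hb i).symm)
    rw [coeff_ofNome_of_notMem γ ha, zero_mul]
  · rintro ⟨a, b⟩ _
    rw [coeff_ofNome_diag, coeff_nomePart]

end NomePart

section Nonresonant

open MvPowerSeries

variable {n : ℕ}

/-- An additive operator, linear over the power series in the nome and triangular with respect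
to the monomials, with diagonal entries `lam`, for which `lam d = lam 0` only if `z ^ d` is a
power of the nome. -/
structure IsNonresonant (L : MvPowerSeries (Fin n) ℂ → MvPowerSeries (Fin n) ℂ)
    (lam : (Fin n →₀ ℕ) → ℂ) : Prop where
  map_sub : ∀ f g, L (f - g) = L f - L g
  map_ofNome_mul : ∀ γ f, L (ofNome γ * f) = ofNome γ * L f
  coeff_eq : ∀ f d, (∀ e < d, coeff e f = 0) → coeff d (L f) = lam d * coeff d f
  mem_range_diag : ∀ d, lam d = lam 0 → d ∈ Set.range (diag n)

variable {L : MvPowerSeries (Fin n) ℂ → MvPowerSeries (Fin n) ℂ} {lam : (Fin n →₀ ℕ) → ℂ}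

theorem IsNonresonant.sub_ne_zero (hL : IsNonresonant L lam) {d : Fin n →₀ ℕ}
    (hd : d ∉ Set.range (diag n)) : lam d - lam 0 ≠ 0 :=
  _root_.sub_ne_zero.2 fun h => hd (hL.mem_range_diag d h)

theorem IsNonresonant.constantCoeff_map (hL : IsNonresonant L lam) (f : MvPowerSeries (Fin n) ℂ) :
    constantCoeff (L f) = lam 0 * constantCoeff f := by
  simp only [← coeff_zero_eq_constantCoeff_apply]
  exact hL.coeff_eq f 0 fun e he => absurd he (by simp)

/-- The eigenvalue of `f` in case `f` is an eigenfunction of `L` with `nomePart f = 1`.  In that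
case it is `nomePart (L f)`; the shift by `lam 0` makes its constant coefficient `lam 0` for
every `f`. -/
noncomputable def eigenvalueOf (L : MvPowerSeries (Fin n) ℂ → MvPowerSeries (Fin n) ℂ)
    (lam : (Fin n →₀ ℕ) → ℂ) (f : MvPowerSeries (Fin n) ℂ) : PowerSeries ℂ :=
  PowerSeries.C (lam 0) + nomePart (L f - lam 0 • f)

theorem IsNonresonant.constantCoeff_eigenvalueOf (hL : IsNonresonant L lam)
    (f : MvPowerSeries (Fin n) ℂ) : PowerSeries.constantCoeff (eigenvalueOf L lam f) = lam 0 := by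
  rw [eigenvalueOf, _root_.map_add, constantCoeff_nomePart, _root_.map_sub, hL.constantCoeff_map,
    PowerSeries.constantCoeff_C, constantCoeff_smul, smul_eq_mul, sub_self, add_zero]

open Classical in
/-- The map whose fixed points are the eigenfunctions `f` of `L` with `nomePart f = 1`. -/
noncomputable def eigenStep (L : MvPowerSeries (Fin n) ℂ → MvPowerSeries (Fin n) ℂ)
    (lam : (Fin n →₀ ℕ) → ℂ) (f : MvPowerSeries (Fin n) ℂ) : MvPowerSeries (Fin n) ℂ := fun d =>
  if d ∈ Set.range (diag n) then coeff d (ofNome 1)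
  else coeff d f + coeff d (ofNome (eigenvalueOf L lam f) * f - L f) / (lam d - lam 0)

theorem coeff_eigenStep_diag (f : MvPowerSeries (Fin n) ℂ) (k : ℕ) :
    coeff (diag n k) (eigenStep L lam f) = coeff (diag n k) (ofNome 1) :=
  if_pos ⟨k, rfl⟩

theorem coeff_eigenStep_of_notMem (f : MvPowerSeries (Fin n) ℂ) {d : Fin n →₀ ℕ}
    (hd : d ∉ Set.range (diag n)) : coeff d (eigenStep L lam f) =
      coeff d f + coeff d (ofNome (eigenvalueOf L lam f) * f - L f) / (lam d - lam 0) :=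
  if_neg hd

variable [NeZero n]

theorem IsNonresonant.eq_zero (hL : IsNonresonant L lam) {f h : MvPowerSeries (Fin n) ℂ}
    {η κ : PowerSeries ℂ} (hη : PowerSeries.constantCoeff η = lam 0) (hf : constantCoeff f = 1)
    (hh : nomePart h = 0) (heq : L h = ofNome η * h + ofNome κ * f) : h = 0 := by
  suffices key : ∀ d, coeff d h = 0 ∧ coeff d (ofNome κ : MvPowerSeries (Fin n) ℂ) = 0 from
    MvPowerSeries.ext fun d => (key d).1
  intro d
  induction d using WellFoundedLT.induction with
  | ind d ih =>
    have hd := congrArg (coeff d) heq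
    rw [hL.coeff_eq h d fun e he => (ih e he).1, _root_.map_add,
      coeff_mul_of_coeff_lt_right fun e he => (ih e he).1,
      coeff_mul_of_coeff_lt_left fun e he => (ih e he).2, constantCoeff_ofNome, hη, hf,
      mul_one] at hd
    by_cases hrange : d ∈ Set.range (diag n)
    · obtain ⟨k, rfl⟩ := hrange
      have hk : coeff (diag n k) h = 0 := by rw [← coeff_nomePart, hh, _root_.map_zero]
      rw [hk, mul_zero, mul_zero, zero_add] at hd
      exact ⟨hk, hd.symm⟩
    · have hκ := coeff_ofNome_of_notMem κ hrange
      rw [hκ, add_zero, ← sub_eq_zero, ← sub_mul] at hd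
      exact ⟨(mul_eq_zero.1 hd).resolve_left (hL.sub_ne_zero hrange), hκ⟩

theorem IsNonresonant.eq_ofNome_mul (hL : IsNonresonant L lam) {f g : MvPowerSeries (Fin n) ℂ}
    {ε η : PowerSeries ℂ} (hf1 : nomePart f = 1) (hf : L f = ofNome ε * f)
    (hη : PowerSeries.constantCoeff η = lam 0) (hg : L g = ofNome η * g) :
    g = ofNome (nomePart g) * f := by
  have hf0 : constantCoeff f = 1 := by rw [← constantCoeff_nomePart, hf1, _root_.map_one]
  refine sub_eq_zero.1 (hL.eq_zero (κ := nomePart g * (η - ε)) hη hf0 ?_ ?_)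
  · rw [_root_.map_sub, nomePart_ofNome_mul, hf1, mul_one, sub_self]
  · rw [hL.map_sub, hL.map_ofNome_mul, hf, hg, ofNome_mul, ofNome_sub]
    ring

theorem IsNonresonant.coeff_eigenvalueOf_sub (hL : IsNonresonant L lam)
    {f g : MvPowerSeries (Fin n) ℂ} {d : Fin n →₀ ℕ} (hd : d ∉ Set.range (diag n))
    (h : ∀ e < d, coeff e (f - g) = 0) {e : Fin n →₀ ℕ} (he : e ≤ d) :
    coeff e (ofNome (eigenvalueOf L lam f - eigenvalueOf L lam g) : MvPowerSeries (Fin n) ℂ) =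
      0 := by
  by_cases hrange : e ∈ Set.range (diag n)
  · obtain ⟨k, rfl⟩ := hrange
    have hlt : diag n k < d := lt_of_le_of_ne he fun h0 => hd ⟨k, h0⟩
    rw [coeff_ofNome_diag, eigenvalueOf, eigenvalueOf, add_sub_add_left_eq_sub,
      ← _root_.map_sub nomePart, sub_sub_sub_comm, ← hL.map_sub, ← smul_sub, coeff_nomePart,
      _root_.map_sub, hL.coeff_eq _ _ fun e he' => h e (he'.trans hlt), coeff_smul, h _ hlt,
      mul_zero, mul_zero, sub_zero]
  · exact coeff_ofNome_of_notMem _ hrange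

theorem IsNonresonant.coeff_eigenStep_eq (hL : IsNonresonant L lam) (f g : MvPowerSeries (Fin n) ℂ)
    (d : Fin n →₀ ℕ) (hfg : ∀ e < d, coeff e f = coeff e g) :
    coeff d (eigenStep L lam f) = coeff d (eigenStep L lam g) := by
  by_cases hd : d ∈ Set.range (diag n)
  · obtain ⟨k, rfl⟩ := hd
    rw [coeff_eigenStep_diag, coeff_eigenStep_diag]
  have hlow : ∀ e < d, coeff e (f - g) = 0 := fun e he => by
    rw [_root_.map_sub, hfg e he, sub_self]
  set ε := eigenvalueOf L lam f with hε
  set δ := eigenvalueOf L lam g with hδ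
  have hlowε : ∀ e ≤ d, coeff e (ofNome (ε - δ) : MvPowerSeries (Fin n) ℂ) = 0 :=
    fun e he => hL.coeff_eigenvalueOf_sub hd hlow he
  have hresidual : coeff d (ofNome ε * f - L f) - coeff d (ofNome δ * g - L g) =
      (lam 0 - lam d) * coeff d (f - g) := by
    have hsplit : ofNome ε * f - L f - (ofNome δ * g - L g) =
        ofNome (ε - δ) * f + ofNome δ * (f - g) - L (f - g) := by
      rw [hL.map_sub, ofNome_sub]
      ring
    rw [← _root_.map_sub, hsplit, _root_.map_sub, _root_.map_add,
      coeff_mul_of_coeff_lt_left fun e he => hlowε e he.le, hlowε d le_rfl,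
      coeff_mul_of_coeff_lt_right hlow, constantCoeff_ofNome, hδ, hL.constantCoeff_eigenvalueOf,
      hL.coeff_eq _ d hlow]
    ring
  rw [coeff_eigenStep_of_notMem f hd, coeff_eigenStep_of_notMem g hd, ← hε, ← hδ, ← sub_eq_zero,
    add_sub_add_comm, ← sub_div, hresidual, ← neg_sub (lam d), neg_mul, neg_div,
    mul_div_cancel_left₀ _ (hL.sub_ne_zero hd), _root_.map_sub, add_neg_cancel]

theorem IsNonresonant.exists_eigenfunction (hL : IsNonresonant L lam) :
    ∃ (f : MvPowerSeries (Fin n) ℂ) (ε : PowerSeries ℂ), nomePart f = 1 ∧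
      PowerSeries.constantCoeff ε = lam 0 ∧ L f = ofNome ε * f := by
  obtain ⟨f, hf⟩ := exists_eq_self_of_causal (eigenStep L lam) hL.coeff_eigenStep_eq
  have hf1 : nomePart f = 1 := by
    ext k
    rw [coeff_nomePart, ← hf, coeff_eigenStep_diag, coeff_ofNome_diag]
  refine ⟨f, eigenvalueOf L lam f, hf1, hL.constantCoeff_eigenvalueOf f, ?_⟩
  ext d
  by_cases hd : d ∈ Set.range (diag n)
  · obtain ⟨k, rfl⟩ := hd
    rw [← coeff_nomePart, ← coeff_nomePart, nomePart_ofNome_mul, hf1, mul_one, eigenvalueOf,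
      _root_.map_sub, _root_.map_smul, hf1, PowerSeries.smul_eq_C_mul, mul_one, add_sub_cancel]
  · have hfix := congrArg (coeff d) hf
    rw [coeff_eigenStep_of_notMem f hd, add_eq_left, div_eq_zero_iff, _root_.map_sub] at hfix
    exact (sub_eq_zero.1 (hfix.resolve_right (hL.sub_ne_zero hd))).symm

end Nonresonant

/-! ### Commutativity of the family -/

section Generic

variable {R ι : Type*} [CommRing R] [IsDomain R] [Uncountable R] [Countable ι]

theorem exists_forall_polynomial_eval_ne_zero {P : ι → Polynomial R} (hP : ∀ i, P i ≠ 0) :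
    ∃ y, ∀ i, (P i).eval y ≠ 0 := by
  by_contra! hroot
  have hcover : (Set.univ : Set R) ⊆ ⋃ i, {y | (P i).IsRoot y} := fun y _ =>
    Set.mem_iUnion.2 (hroot y)
  have hcountable : (⋃ i, {y | (P i).IsRoot y}).Countable :=
    Set.countable_iUnion fun i => (Polynomial.finite_setOfPred_isRoot (hP i)).countable
  exact Set.not_countable_univ (hcountable.mono hcover)

theorem exists_forall_mvPolynomial_eval_ne_zero {n : ℕ} {P : ι → MvPolynomial (Fin n) R}
    (hP : ∀ i, P i ≠ 0) : ∃ s, ∀ i, MvPolynomial.eval s (P i) ≠ 0 := by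
  induction n with
  | zero =>
    refine ⟨Fin.elim0, fun i h => hP i ?_⟩
    rw [MvPolynomial.eq_C_of_isEmpty (P i)] at h ⊢
    rw [MvPolynomial.eval_C] at h
    rw [h, map_zero]
  | succ n ih =>
    have hlead : ∀ i, (MvPolynomial.finSuccEquiv R n (P i)).leadingCoeff ≠ 0 := fun i =>
      Polynomial.leadingCoeff_ne_zero.2 ((map_ne_zero_iff _
        (MvPolynomial.finSuccEquiv R n).injective).2 (hP i))
    obtain ⟨s, hs⟩ := ih hlead
    obtain ⟨y, hy⟩ := exists_forall_polynomial_eval_ne_zero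
      (P := fun i => (MvPolynomial.finSuccEquiv R n (P i)).map (MvPolynomial.eval s))
      fun i h => hs i (by
        rw [← Polynomial.leadingCoeff_map_of_leadingCoeff_ne_zero _ (hs i), h,
          Polynomial.leadingCoeff_zero])
    exact ⟨Fin.cons y s, fun i => by rw [MvPolynomial.eval_eq_eval_mv_eval']; exact hy i⟩

instance uncountable_complex : Uncountable ℂ :=
  ⟨fun _ => not_countable_complex Set.countable_univ⟩

end Generic

section Operators

open MvPowerSeries

variable {n : ℕ} [NeZero n] {q : ℂ}

theorem xExponent_zero (i : Fin n) : xExponent (0 : Fin n →₀ ℕ) i = 0 := sub_self _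

theorem shiftFactor_diag (q : ℂ) (I : Finset (Fin n)) (k : ℕ) :
    shiftFactor q I (diag n k) = 1 := by
  simp [shiftFactor, xExponent, diag_apply]

theorem qShift_ofNome_mul (hq : q ≠ 0) (I : Finset (Fin n)) (γ : PowerSeries ℂ)
    (f : MvPowerSeries (Fin n) ℂ) : qShift q I (ofNome γ * f) = ofNome γ * qShift q I f := by
  have hγ : shiftHom q I (ofNome γ) = ofNome γ := by
    ext d
    rw [shiftHom_apply hq, coeff_qShift]
    by_cases hd : d ∈ Set.range (diag n)
    · obtain ⟨k, rfl⟩ := hd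
      rw [shiftFactor_diag, one_mul]
    · rw [coeff_ofNome_of_notMem γ hd, mul_zero]
  rw [← shiftHom_apply hq, map_mul, hγ, shiftHom_apply hq]

theorem modifiedOperator_ofNome_mul (hq : q ≠ 0) (t : ℂ) (s : Fin n → ℂ) (r : ℕ)
    (γ : PowerSeries ℂ) (f : MvPowerSeries (Fin n) ℂ) :
    modifiedOperator q t s r (ofNome γ * f) = ofNome γ * modifiedOperator q t s r f := by
  simp only [modifiedOperator, Finset.mul_sum, qShift_ofNome_mul hq, mul_left_comm (ofNome γ)]

theorem modifiedOperator_sub (hq : q ≠ 0) (t : ℂ) (s : Fin n → ℂ) (r : ℕ)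
    (f g : MvPowerSeries (Fin n) ℂ) :
    modifiedOperator q t s r (f - g) = modifiedOperator q t s r f - modifiedOperator q t s r g := by
  simp only [modifiedOperator, ← shiftHom_apply hq, map_sub, mul_sub, Finset.sum_sub_distrib]

theorem modifiedOperator_sum (hq : q ≠ 0) (t : ℂ) (s : Fin n → ℂ) (r : ℕ) {ι : Type*}
    (A : Finset ι) (F : ι → MvPowerSeries (Fin n) ℂ) :
    modifiedOperator q t s r (∑ a ∈ A, F a) = ∑ a ∈ A, modifiedOperator q t s r (F a) := by
  simp only [modifiedOperator, ← shiftHom_apply hq, map_sum, Finset.mul_sum]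
  exact Finset.sum_comm

/-- The diagonal entries of the modified operators with respect to the monomials `z ^ d`: the
elementary symmetric polynomials in the numbers `s_i q ^ e_i`, where `e_i` is the exponent of
`x_i` in `z ^ d`. -/
noncomputable def diagEntry (q : ℂ) (s : Fin n → ℂ) (r : ℕ) (d : Fin n →₀ ℕ) : ℂ :=
  ∑ I ∈ Finset.powersetCard r (Finset.univ : Finset (Fin n)), ∏ i ∈ I, s i * q ^ xExponent d i

theorem coeff_modifiedOperator (q t : ℂ) (s : Fin n → ℂ) (r : ℕ) {f : MvPowerSeries (Fin n) ℂ}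
    {d : Fin n →₀ ℕ} (h : ∀ e < d, coeff e f = 0) :
    coeff d (modifiedOperator q t s r f) = diagEntry q s r d * coeff d f := by
  rw [modifiedOperator, map_sum, diagEntry, Finset.sum_mul]
  refine Finset.sum_congr rfl fun I _ => ?_
  rw [coeff_mul_of_coeff_lt_right fun e he => by rw [coeff_qShift, h e he, mul_zero],
    map_mul, constantCoeff_C, constantCoeff_coeffB, mul_one, coeff_qShift, shiftFactor,
    Finset.prod_mul_distrib, mul_assoc]

theorem isNonresonant_modifiedOperator_one (hq : q ≠ 0) (t : ℂ) {s : Fin n → ℂ}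
    (hs : ∀ d : Fin n →₀ ℕ, d ∉ Set.range (diag n) → ∑ i, s i * (q ^ xExponent d i - 1) ≠ 0) :
    IsNonresonant (modifiedOperator q t s 1) (diagEntry q s 1) where
  map_sub := modifiedOperator_sub hq t s 1
  map_ofNome_mul := modifiedOperator_ofNome_mul hq t s 1
  coeff_eq _ _ h := coeff_modifiedOperator q t s 1 h
  mem_range_diag d h := by
    have hentry : ∀ d, diagEntry q s 1 d = ∑ i, s i * q ^ xExponent d i := fun d => by
      simp [diagEntry, Finset.powersetCard_one]
    by_contra hd
    refine hs d hd ?_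
    rw [hentry, hentry, ← sub_eq_zero, ← Finset.sum_sub_distrib] at h
    simpa only [xExponent_zero, zpow_zero, ← mul_sub] using h

theorem IsNonresonant.exists_eigenvalue
    {L M : MvPowerSeries (Fin n) ℂ → MvPowerSeries (Fin n) ℂ} {lam : (Fin n →₀ ℕ) → ℂ}
    (hL : IsNonresonant L lam) (hM : ∀ γ f, M (ofNome γ * f) = ofNome γ * M f)
    (hLM : ∀ f, L (M f) = M (L f)) {f : MvPowerSeries (Fin n) ℂ} {ε : PowerSeries ℂ}
    (hf1 : nomePart f = 1) (hε : PowerSeries.constantCoeff ε = lam 0) (hf : L f = ofNome ε * f) :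
    ∃ η : PowerSeries ℂ, M f = ofNome η * f :=
  ⟨nomePart (M f), hL.eq_ofNome_mul hf1 hf hε (by rw [hLM, hf, hM])⟩

theorem exists_joint_eigenfunction (hq0 : q ≠ 0) (hq1 : q ≠ 1) {t : ℂ} (ht : t ≠ 0)
    {s : Fin n → ℂ}
    (hs : ∀ d : Fin n →₀ ℕ, d ∉ Set.range (diag n) → ∑ i, s i * (q ^ xExponent d i - 1) ≠ 0) :
    ∃ f : MvPowerSeries (Fin n) ℂ, constantCoeff f = 1 ∧
      ∀ r, ∃ η : PowerSeries ℂ, modifiedOperator q t s r f = ofNome η * f := by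
  have hL := isNonresonant_modifiedOperator_one hq0 t hs
  obtain ⟨f, ε, hf1, hε, hf⟩ := hL.exists_eigenfunction
  refine ⟨f, by rw [← constantCoeff_nomePart, hf1, map_one], fun r => ?_⟩
  exact hL.exists_eigenvalue (modifiedOperator_ofNome_mul hq0 t s r)
    (modifiedOperator_one_comm hq0 hq1 ht s r) hf1 hε hf

end Operators

section Commute

open MvPowerSeries

variable {n : ℕ} [NeZero n] {q : ℂ}

/-- The `q`-shift of the variables `x_i`, `i ∈ M`, with multiplicities. -/
noncomputable def multiShift (q : ℂ) (M : Multiset (Fin n)) (f : MvPowerSeries (Fin n) ℂ) :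
    MvPowerSeries (Fin n) ℂ :=
  fun d => (M.map fun i => q ^ xExponent d i).prod * coeff d f

theorem qShift_qShift (q : ℂ) (I J : Finset (Fin n)) (f : MvPowerSeries (Fin n) ℂ) :
    qShift q I (qShift q J f) = multiShift q (I.val + J.val) f := by
  ext d
  change _ = (Multiset.map _ (I.val + J.val)).prod * coeff d f
  rw [coeff_qShift, coeff_qShift, Multiset.map_add, Multiset.prod_add, mul_assoc]
  rfl

theorem constantCoeff_multiShift (q : ℂ) (M : Multiset (Fin n)) (f : MvPowerSeries (Fin n) ℂ) :
    constantCoeff (multiShift q M f) = constantCoeff f := by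
  rw [← coeff_zero_eq_constantCoeff_apply]
  change (Multiset.map _ M).prod * coeff 0 f = coeff 0 f
  simp [xExponent]

/-- The multisets `I + J` with `|I| = r` and `|J| = l`: they index the multiple `q`-shifts that
occur in the product of the modified operators of orders `r` and `l`. -/
def shiftTypes (n r l : ℕ) : Finset (Multiset (Fin n)) :=
  (Finset.powersetCard r Finset.univ ×ˢ Finset.powersetCard l Finset.univ).image
    fun p : Finset (Fin n) × Finset (Fin n) => p.1.val + p.2.val

/-- The coefficient of `s ^ M` times the multiple `q`-shift `M` in the commutator of the modified
operators of orders `r` and `l`. -/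
noncomputable def commCoeff (q t : ℂ) (r l : ℕ) (M : Multiset (Fin n)) :
    MvPowerSeries (Fin n) ℂ :=
  ∑ p ∈ Finset.powersetCard r Finset.univ ×ˢ Finset.powersetCard l Finset.univ with
    p.1.val + p.2.val = M,
      (coeffB t p.1 * shiftHom q p.1 (coeffB t p.2) - coeffB t p.2 * shiftHom q p.2 (coeffB t p.1))

theorem commCoeff_eq_zero_of_notMem (q t : ℂ) {r l : ℕ} {M : Multiset (Fin n)}
    (hM : M ∉ shiftTypes n r l) : commCoeff q t r l M = 0 := by
  rw [commCoeff, Finset.filter_eq_empty_iff.2, Finset.sum_empty]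
  exact fun p hp h => hM (Finset.mem_image.2 ⟨p, hp, h⟩)

theorem modifiedOperator_commutator (hq : q ≠ 0) (t : ℂ) (s : Fin n → ℂ) (r l : ℕ)
    (f : MvPowerSeries (Fin n) ℂ) :
    modifiedOperator q t s r (modifiedOperator q t s l f) -
        modifiedOperator q t s l (modifiedOperator q t s r f) =
      ∑ M ∈ shiftTypes n r l,
        C (M.map s).prod * (commCoeff q t r l M * multiShift q M f) := by
  rw [modifiedOperator_modifiedOperator hq, modifiedOperator_modifiedOperator hq,
    Finset.sum_comm (s := Finset.powersetCard l Finset.univ), ← Finset.sum_product',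
    ← Finset.sum_product', ← Finset.sum_sub_distrib, shiftTypes,
    ← Finset.sum_fiberwise_of_maps_to fun p hp => Finset.mem_image_of_mem
      (fun p : Finset (Fin n) × Finset (Fin n) => p.1.val + p.2.val) hp]
  refine Finset.sum_congr rfl fun M _ => ?_
  rw [commCoeff, Finset.sum_mul, Finset.mul_sum]
  refine Finset.sum_congr rfl fun p hp => ?_
  have hM : p.1.val + p.2.val = M := (Finset.mem_filter.1 hp).2
  have hs : (M.map s).prod = (∏ i ∈ p.1, s i) * ∏ j ∈ p.2, s j := by
    rw [← hM, Multiset.map_add, Multiset.prod_add]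
    rfl
  rw [qShift_comm q p.2 p.1, qShift_qShift, hM, hs, mul_comm (∏ i ∈ p.2, s i)]
  ring

theorem sum_coeff_commCoeff_eq_zero (hq0 : q ≠ 0) (hq1 : q ≠ 1) {t : ℂ} (ht : t ≠ 0)
    {s : Fin n → ℂ}
    (hs : ∀ d : Fin n →₀ ℕ, d ∉ Set.range (diag n) → ∑ i, s i * (q ^ xExponent d i - 1) ≠ 0)
    {r l : ℕ} {d : Fin n →₀ ℕ} (hd : ∀ e < d, ∀ M, coeff e (commCoeff q t r l M) = 0) :
    ∑ M ∈ shiftTypes n r l, coeff d (commCoeff q t r l M) * (M.map s).prod = 0 := by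
  obtain ⟨f, hf1, hf⟩ := exists_joint_eigenfunction hq0 hq1 ht hs
  obtain ⟨η, hη⟩ := hf r
  obtain ⟨κ, hκ⟩ := hf l
  have hcomm := modifiedOperator_commutator hq0 t s r l f
  rw [hη, hκ, modifiedOperator_ofNome_mul hq0, modifiedOperator_ofNome_mul hq0, hη, hκ,
    mul_left_comm, sub_self] at hcomm
  rw [← map_zero (coeff d), hcomm, map_sum]
  refine Finset.sum_congr rfl fun M _ => ?_
  rw [coeff_C_mul, coeff_mul_of_coeff_lt_left fun e he => hd e he M, constantCoeff_multiShift, hf1,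
    mul_one, mul_comm]

theorem exists_eval_ne_zero_of_ne_zero (hq : ∀ m : ℤ, m ≠ 0 → q ^ m ≠ 1)
    {Q : MvPolynomial (Fin n) ℂ} (hQ : Q ≠ 0) :
    ∃ s : Fin n → ℂ, MvPolynomial.eval s Q ≠ 0 ∧ ∀ d : Fin n →₀ ℕ, d ∉ Set.range (diag n) →
      ∑ i, s i * (q ^ xExponent d i - 1) ≠ 0 := by
  classical
  let P (d : Fin n →₀ ℕ) : MvPolynomial (Fin n) ℂ :=
    ∑ i, MvPolynomial.X i * MvPolynomial.C (q ^ xExponent d i - 1)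
  have hP : ∀ d, d ∉ Set.range (diag n) → P d ≠ 0 := fun d hd h => by
    refine hd (mem_range_diag_of_xExponent fun i => ?_)
    by_contra hi
    refine hq _ hi (sub_eq_zero.1 ?_)
    simpa [P, Pi.single_apply] using congrArg (MvPolynomial.eval (Pi.single i 1)) h
  obtain ⟨s, hs⟩ := exists_forall_mvPolynomial_eval_ne_zero
    (P := fun o : Option {d : Fin n →₀ ℕ // d ∉ Set.range (diag n)} => o.elim Q fun d => P d)
    (by rintro (_ | d); exacts [hQ, hP d d.2])
  refine ⟨s, hs none, fun d hd => ?_⟩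
  simpa [P] using hs (some ⟨d, hd⟩)

theorem commCoeff_eq_zero (hq0 : q ≠ 0) (hq : ∀ m : ℤ, m ≠ 0 → q ^ m ≠ 1) {t : ℂ} (ht : t ≠ 0)
    (r l : ℕ) (M : Multiset (Fin n)) : commCoeff q t r l M = 0 := by
  suffices h : ∀ (d : Fin n →₀ ℕ) M, coeff d (commCoeff q t r l M) = 0 from
    MvPowerSeries.ext fun d => h d M
  intro d
  induction d using WellFoundedLT.induction with
  | ind d ih =>
    let Q : MvPolynomial (Fin n) ℂ := ∑ M ∈ shiftTypes n r l,
      MvPolynomial.monomial (Multiset.toFinsupp M) (coeff d (commCoeff q t r l M))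
    have heval : ∀ s, MvPolynomial.eval s Q =
        ∑ M ∈ shiftTypes n r l, coeff d (commCoeff q t r l M) * (M.map s).prod := fun s => by
      simp only [Q, map_sum, MvPolynomial.eval_monomial, Finset.prod_multiset_map_count]
      rfl
    have hQ : Q = 0 := by
      by_contra hne
      obtain ⟨s, hsQ, hs⟩ := exists_eval_ne_zero_of_ne_zero hq hne
      have hq1 : q ≠ 1 := fun h => hq 1 one_ne_zero (by rw [h, one_zpow])
      exact hsQ ((heval s).trans (sum_coeff_commCoeff_eq_zero hq0 hq1 ht hs ih))
    intro M
    by_cases hM : M ∈ shiftTypes n r l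
    · have hcoeff := congrArg (MvPolynomial.coeff (Multiset.toFinsupp M)) hQ
      simpa only [Q, MvPolynomial.coeff_sum, MvPolynomial.coeff_monomial,
        EmbeddingLike.apply_eq_iff_eq, Finset.sum_ite_eq', if_pos hM,
        MvPolynomial.coeff_zero] using hcoeff
    · rw [commCoeff_eq_zero_of_notMem q t hM, map_zero]

theorem modifiedOperator_comm (hq0 : q ≠ 0) (hq : ∀ m : ℤ, m ≠ 0 → q ^ m ≠ 1) {t : ℂ}
    (ht : t ≠ 0) (s : Fin n → ℂ) (r l : ℕ) (f : MvPowerSeries (Fin n) ℂ) :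
    modifiedOperator q t s r (modifiedOperator q t s l f) =
      modifiedOperator q t s l (modifiedOperator q t s r f) := by
  rw [← sub_eq_zero, modifiedOperator_commutator hq0]
  exact Finset.sum_eq_zero fun M _ => by rw [commCoeff_eq_zero hq0 hq ht, zero_mul, mul_zero]

end Commute

/-! ### The generating operator -/

theorem zpow_ne_one_of_norm_ne_one {K : Type*} [NormedDivisionRing K] {x : K} (hx : ‖x‖ ≠ 1)
    {m : ℤ} (hm : m ≠ 0) : x ^ m ≠ 1 := fun h =>
  hm ((zpow_eq_one_iff_right₀ (norm_nonneg x) hx).1 (by rw [← norm_zpow, h, norm_one]))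

theorem exists_eq_of_prod_one_add_mul_eq {F ι : Type*} [Field F] [Fintype ι] {a b : ι → F}
    (h : ∀ u, ∏ i, (1 + a i * u) = ∏ i, (1 + b i * u)) {i : ι} (hi : a i ≠ 0) :
    ∃ j, b j = a i := by
  have hroot : ∏ j, (1 + b j * -(a i)⁻¹) = 0 := by
    rw [← h]
    exact Finset.prod_eq_zero (Finset.mem_univ i) (by
      rw [mul_neg, mul_inv_cancel₀ hi, add_neg_cancel])
  obtain ⟨j, -, hj⟩ := Finset.prod_eq_zero_iff.1 hroot
  rw [mul_neg, ← sub_eq_add_neg, sub_eq_zero, eq_comm, ← div_eq_mul_inv, div_eq_one_iff_eq hi] at hj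
  exact ⟨j, hj⟩

section GeneratingOperator

open MvPowerSeries

variable {n : ℕ} [NeZero n] {q t : ℂ} {s : Fin n → ℂ} {u : ℂ}

theorem sum_xExponent (d : Fin n →₀ ℕ) : ∑ i, xExponent d i = 0 := by
  simp only [xExponent, Finset.sum_sub_distrib]
  rw [sub_eq_zero]
  exact (Equiv.sum_comp (Equiv.addRight (1 : Fin n)) fun i => (d i : ℤ)).symm

/-- The diagonal entries of the generating operator `∑ r, u ^ r 𝓔^{(r)}` with respect to the
monomials `z ^ d`. -/
noncomputable def generatingEntry (q : ℂ) (s : Fin n → ℂ) (u : ℂ) (d : Fin n →₀ ℕ) : ℂ :=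
  ∑ r ∈ Finset.Icc 1 n, u ^ r * diagEntry q s r d

theorem generatingEntry_add_one (q : ℂ) (s : Fin n → ℂ) (u : ℂ) (d : Fin n →₀ ℕ) :
    generatingEntry q s u d + 1 = ∏ i, (1 + s i * q ^ xExponent d i * u) := by
  rw [Finset.prod_one_add, Finset.sum_powerset, Finset.card_univ, Fintype.card_fin,
    Finset.range_eq_Ico, Finset.sum_eq_sum_Ico_succ_bot n.succ_pos, Finset.powersetCard_zero,
    Finset.sum_singleton, Finset.prod_empty, add_comm, generatingEntry]
  refine congrArg (1 + ·) (Finset.sum_congr rfl fun r _ => ?_)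
  rw [diagEntry, Finset.mul_sum]
  refine Finset.sum_congr rfl fun I hI => ?_
  rw [Finset.prod_mul_distrib (g := fun _ => u), Finset.prod_const,
    (Finset.mem_powersetCard.1 hI).2, mul_comm]

theorem exists_generatingEntry_eq_eval (q : ℂ) (s : Fin n → ℂ) (d : Fin n →₀ ℕ) :
    ∃ P : Polynomial ℂ, ∀ u, generatingEntry q s u d = P.eval u :=
  ⟨∑ r ∈ Finset.Icc 1 n, Polynomial.X ^ r * Polynomial.C (diagEntry q s r d), fun u => by
    simp only [generatingEntry, Polynomial.eval_finsetSum, Polynomial.eval_mul,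
      Polynomial.eval_pow, Polynomial.eval_X, Polynomial.eval_C]⟩

theorem xExponent_eq_zero_of_generatingEntry_eq (hq0 : q ≠ 0)
    (hq : ∀ m : ℤ, m ≠ 0 → q ^ m ≠ 1)
    (hs : ∀ i j : Fin n, i < j → ∀ m : ℤ, m ≠ 0 → s j ≠ q ^ m * s i) {d : Fin n →₀ ℕ}
    (h : ∀ u, generatingEntry q s u d = generatingEntry q s u 0) {i : Fin n} (hi : s i ≠ 0) :
    xExponent d i = 0 := by
  by_contra he
  have hprod : ∀ u, ∏ i, (1 + s i * q ^ xExponent d i * u) = ∏ i, (1 + s i * u) := fun u => by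
    rw [← generatingEntry_add_one, h, generatingEntry_add_one]
    simp only [xExponent_zero, zpow_zero, mul_one]
  obtain ⟨j, hj⟩ := exists_eq_of_prod_one_add_mul_eq hprod (mul_ne_zero hi (zpow_ne_zero _ hq0))
  rcases lt_trichotomy i j with hij | rfl | hij
  · exact hs i j hij _ he (hj.trans (mul_comm _ _))
  · exact hq _ he ((mul_eq_left₀ hi).1 hj.symm)
  · refine hs j i hij _ (neg_ne_zero.2 he) ?_
    rw [hj, mul_comm, mul_assoc, ← zpow_add₀ hq0, add_neg_cancel, zpow_zero, mul_one]

theorem mem_range_diag_of_generatingEntry_eq (hq0 : q ≠ 0) (hq : ∀ m : ℤ, m ≠ 0 → q ^ m ≠ 1)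
    (hs : ∀ i j : Fin n, i < j → ∀ m : ℤ, m ≠ 0 → s j ≠ q ^ m * s i) {d : Fin n →₀ ℕ}
    (h : ∀ u, generatingEntry q s u d = generatingEntry q s u 0) : d ∈ Set.range (diag n) := by
  refine mem_range_diag_of_xExponent fun i => ?_
  have hne : ∀ j, s j ≠ 0 → xExponent d j = 0 := fun j =>
    xExponent_eq_zero_of_generatingEntry_eq hq0 hq hs h
  by_cases hi : s i = 0
  · -- At most one `s j` vanishes, and the exponents add up to `0`.
    have hother : ∀ j, j ≠ i → s j ≠ 0 := fun j hji hj => by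
      rcases hji.lt_or_gt with hlt | hlt
      exacts [hs j i hlt 1 one_ne_zero (by rw [hi, hj, mul_zero]),
        hs i j hlt 1 one_ne_zero (by rw [hi, hj, mul_zero])]
    rw [← Fintype.sum_eq_single i fun j hji => hne j (hother j hji), sum_xExponent]
  · exact hne i hi

theorem exists_forall_mem_range_diag (hq0 : q ≠ 0) (hq : ∀ m : ℤ, m ≠ 0 → q ^ m ≠ 1)
    (hs : ∀ i j : Fin n, i < j → ∀ m : ℤ, m ≠ 0 → s j ≠ q ^ m * s i) :
    ∃ u : ℂ, ∀ d : Fin n →₀ ℕ, generatingEntry q s u d = generatingEntry q s u 0 →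
      d ∈ Set.range (diag n) := by
  choose P hP using exists_generatingEntry_eq_eval q s
  obtain ⟨u, hu⟩ := exists_forall_polynomial_eval_ne_zero
    (P := fun d : {d : Fin n →₀ ℕ // d ∉ Set.range (diag n)} => P d - P 0) fun d h =>
      d.2 (mem_range_diag_of_generatingEntry_eq hq0 hq hs fun u => by
        rw [hP, hP, sub_eq_zero.1 h])
  refine ⟨u, fun d h => ?_⟩
  by_contra hd
  exact hu ⟨d, hd⟩ (by rw [Polynomial.eval_sub, ← hP, ← hP, h, sub_self])

/-- The generating operator `∑ r, u ^ r 𝓔^{(r)}` of the modified operators. -/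
noncomputable def generatingOperator (q t : ℂ) (s : Fin n → ℂ) (u : ℂ)
    (f : MvPowerSeries (Fin n) ℂ) : MvPowerSeries (Fin n) ℂ :=
  ∑ r ∈ Finset.Icc 1 n, ofNome (PowerSeries.C (u ^ r)) * modifiedOperator q t s r f

theorem isNonresonant_generatingOperator (hq : q ≠ 0) (t : ℂ)
    (hu : ∀ d : Fin n →₀ ℕ, generatingEntry q s u d = generatingEntry q s u 0 →
      d ∈ Set.range (diag n)) :
    IsNonresonant (generatingOperator q t s u) (generatingEntry q s u) where
  map_sub f g := by
    simp only [generatingOperator, modifiedOperator_sub hq, mul_sub, Finset.sum_sub_distrib]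
  map_ofNome_mul γ f := by
    simp only [generatingOperator, modifiedOperator_ofNome_mul hq, Finset.mul_sum,
      mul_left_comm (ofNome γ)]
  coeff_eq f d h := by
    simp only [generatingOperator, generatingEntry, map_sum, Finset.sum_mul, ofNome_C,
      coeff_C_mul, coeff_modifiedOperator q t s _ h, mul_assoc]
  mem_range_diag := hu

theorem generatingOperator_modifiedOperator_comm (hq0 : q ≠ 0)
    (hq : ∀ m : ℤ, m ≠ 0 → q ^ m ≠ 1) (ht : t ≠ 0) (s : Fin n → ℂ) (u : ℂ) (r : ℕ)
    (f : MvPowerSeries (Fin n) ℂ) :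
    generatingOperator q t s u (modifiedOperator q t s r f) =
      modifiedOperator q t s r (generatingOperator q t s u f) := by
  rw [generatingOperator, generatingOperator, modifiedOperator_sum hq0]
  refine Finset.sum_congr rfl fun l _ => ?_
  rw [modifiedOperator_ofNome_mul hq0, modifiedOperator_comm hq0 hq ht]

end GeneratingOperator

namespace IsFormalSolution

open MvPowerSeries

variable {n : ℕ} [NeZero n] {q t : ℂ} {s : Fin n → ℂ} {f g : MvPowerSeries (Fin n) ℂ}
  {ε η : ℕ → PowerSeries ℂ}

theorem constantCoeff_eq_diagEntry (hf : IsFormalSolution q t s f ε) {r : ℕ}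
    (hr : r ∈ Finset.Icc 1 n) : PowerSeries.constantCoeff (ε r) = diagEntry q s r 0 := by
  have hcoeff := congrArg (coeff 0) (hf.2 r hr)
  rw [coeff_modifiedOperator q t s r fun e he => absurd he (by simp),
    coeff_zero_eq_constantCoeff_apply, coeff_zero_eq_constantCoeff_apply, map_mul,
    constantCoeff_ofNome, hf.1, mul_one, mul_one] at hcoeff
  exact hcoeff.symm

theorem exists_generatingOperator_eq (hf : IsFormalSolution q t s f ε) (u : ℂ) :
    ∃ ζ : PowerSeries ℂ, PowerSeries.constantCoeff ζ = generatingEntry q s u 0 ∧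
      generatingOperator q t s u f = ofNome ζ * f := by
  refine ⟨∑ r ∈ Finset.Icc 1 n, PowerSeries.C (u ^ r) * ε r, ?_, ?_⟩
  · rw [map_sum, generatingEntry]
    refine Finset.sum_congr rfl fun r hr => ?_
    rw [map_mul, PowerSeries.constantCoeff_C, hf.constantCoeff_eq_diagEntry hr]
  · rw [generatingOperator, ofNome_sum, Finset.sum_mul]
    refine Finset.sum_congr rfl fun r hr => ?_
    rw [hf.2 r hr, ofNome_mul, mul_assoc]

theorem ofNome_mul (hq : q ≠ 0) (hf : IsFormalSolution q t s f ε) {γ : PowerSeries ℂ}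
    (hγ : PowerSeries.constantCoeff γ = 1) : IsFormalSolution q t s (ofNome γ * f) ε :=
  ⟨by rw [map_mul, constantCoeff_ofNome, hγ, hf.1, mul_one], fun r hr => by
    rw [modifiedOperator_ofNome_mul hq, hf.2 r hr, mul_left_comm]⟩

theorem eigenvalue_unique (hε : IsFormalSolution q t s f ε) (hη : IsFormalSolution q t s f η)
    {r : ℕ} (hr : r ∈ Finset.Icc 1 n) : η r = ε r := by
  have hf : nomePart f ≠ 0 := fun h => by
    simpa [h, hε.1] using constantCoeff_nomePart f
  refine mul_right_cancel₀ hf ?_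
  rw [← nomePart_ofNome_mul, ← nomePart_ofNome_mul, ← hη.2 r hr, ← hε.2 r hr]

end IsFormalSolution

end Ruijsenaars

theorem theorem2p5_general (n : ℕ) [NeZero n] (q t : ℂ) (hq0 : q ≠ 0)
    (hq : ∀ m : ℤ, m ≠ 0 → q ^ m ≠ 1) (ht : t ≠ 0) (s : Fin n → ℂ)
    (hs : ∀ i j : Fin n, i < j → ∀ m : ℤ, m ≠ 0 → s j ≠ q ^ m * s i) :
    ∃ (f : MvPowerSeries (Fin n) ℂ) (ε : ℕ → PowerSeries ℂ),
      Ruijsenaars.IsFormalSolution q t s f ε ∧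
      (∀ (g : MvPowerSeries (Fin n) ℂ) (η : ℕ → PowerSeries ℂ),
        Ruijsenaars.IsFormalSolution q t s g η → ∀ r ∈ Finset.Icc 1 n, η r = ε r) ∧
      (∀ g : MvPowerSeries (Fin n) ℂ,
        (∃ η : ℕ → PowerSeries ℂ, Ruijsenaars.IsFormalSolution q t s g η) ↔
          ∃ γ : PowerSeries ℂ, PowerSeries.constantCoeff γ = 1 ∧
            g = Ruijsenaars.ofNome γ * f) := by
  open Ruijsenaars in
  obtain ⟨u, hu⟩ := exists_forall_mem_range_diag hq0 hq hs
  have hL := isNonresonant_generatingOperator hq0 t hu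
  obtain ⟨f, ζ, hf1, hζ, hLf⟩ := hL.exists_eigenfunction
  choose ε hε using fun r => hL.exists_eigenvalue (modifiedOperator_ofNome_mul hq0 t s r)
    (generatingOperator_modifiedOperator_comm hq0 hq ht s u r) hf1 hζ hLf
  have hf : IsFormalSolution q t s f ε :=
    ⟨by rw [← constantCoeff_nomePart, hf1, map_one], fun r _ => hε r⟩
  have hmultiple : ∀ g η, IsFormalSolution q t s g η → ∃ γ : PowerSeries ℂ,
      PowerSeries.constantCoeff γ = 1 ∧ g = ofNome γ * f := fun g η hg => by
    obtain ⟨κ, hκ, hLg⟩ := hg.exists_generatingOperator_eq u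
    exact ⟨nomePart g, by rw [constantCoeff_nomePart, hg.1], hL.eq_ofNome_mul hf1 hLf hκ hLg⟩
  refine ⟨f, ε, hf, fun g η hg r hr => ?_, fun g =>
    ⟨fun ⟨η, hg⟩ => hmultiple g η hg, fun ⟨γ, hγ, hg⟩ => ⟨ε, hg ▸ hf.ofNome_mul hq0 hγ⟩⟩⟩
  obtain ⟨γ, hγ, rfl⟩ := hmultiple g η hg
  exact (hf.ofNome_mul hq0 hγ).eigenvalue_unique hg hr

theorem theorem2p5 (n : ℕ) [NeZero n] (q t : ℂ) (hq0 : q ≠ 0) (hq1 : ‖q‖ < 1) (ht : t ≠ 0)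
    (s : Fin n → ℂ) (hs0 : ∀ i, s i ≠ 0)
    (hs : ∀ i j : Fin n, i < j → ∀ m : ℤ, m ≠ 0 → s j / s i ≠ q ^ m) :
    ∃ (f : MvPowerSeries (Fin n) ℂ) (ε : ℕ → PowerSeries ℂ),
      Ruijsenaars.IsFormalSolution q t s f ε ∧
      (∀ (g : MvPowerSeries (Fin n) ℂ) (η : ℕ → PowerSeries ℂ),
        Ruijsenaars.IsFormalSolution q t s g η → ∀ r ∈ Finset.Icc 1 n, η r = ε r) ∧
      (∀ g : MvPowerSeries (Fin n) ℂ,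
        (∃ η : ℕ → PowerSeries ℂ, Ruijsenaars.IsFormalSolution q t s g η) ↔
          ∃ γ : PowerSeries ℂ, PowerSeries.constantCoeff γ = 1 ∧
            g = Ruijsenaars.ofNome γ * f) :=
  theorem2p5_general n q t hq0 (fun _ => Ruijsenaars.zpow_ne_one_of_norm_ne_one hq1.ne) ht s
    fun i j hij m hm h => hs i j hij m hm (by rw [h, mul_div_cancel_right₀ _ (hs0 i)])
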